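/- Conventions. Let $d\ge 0$ be an integer. A weight $\omega$ on $\mathbf R^{n}$ belongs to $\mathscr P(\mathbf R^{n})$ if it is positive and measurable and there are $C,N$ with $\omega(X+Y)\le C\,\omega(X)(1+|Y|)^N$ for all $X,Y$. For a tempered distribution $f\in\mathscr S'(\mathbf R^n)$ and a window $\varphi\in\mathscr S(\mathbf R^n)$, the short-time Fourier transform is the function $$V_\varphi f(x,\xi)=(2\pi)^{-n/2}\big\langle f,\overline{\varphi(\cdot-x)}\,e^{-i\langle\cdot,\xi\rangle}\big\rangle ,\qquad x,\xi\in\mathbf R^n .$$ If also $f\in\mathscr S(\mathbf R^n)$, then $V_\varphi f\in\mathscr S(\mathbf R^{2n})$. For a window $\varphi\in\mathscr S'(\mathbf R^n)$, $V_\varphi f$ is the tempered distribution on $\mathbf R^{2n}$ given by the partial Fourier transform (normalized by $(2\pi)^{-n/2}$, with kernel $e^{-i\langle y,\xi\rangle}$) with respect to $y$ of the distribution $f(y)\,\overline{\varphi(y-x)}$. For $p,q\in[1,\infty]$ set $$\|F\|_{L^{p,q}_{1,(\omega)}}=\Big\|\,\xi\mapsto\|F(\cdot,\xi)\,\omega(\cdot,\xi)\|_{L^p}\Big\|_{L^q},\qquad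 \|F\|_{L^{p,q}_{2,(\omega)}}=\Big\|\,x\mapsto\|F(x,\cdot)\,\omega(x,\cdot)\|_{L^q}\Big\|_{L^p}.$$ For a fixed window $\chi\in\mathscr S\setminus\{0\}$, $M^{p,q}_{(\omega)}$ (respectively $W^{p,q}_{(\omega)}$) is the set of tempered distributions $f$ for which $\|f\|_{M^{p,q}_{(\omega)}}=\|V_\chi f\|_{L^{p,q}_{1,(\omega)}}$ (respectively $\|f\|_{W^{p,q}_{(\omega)}}=\|V_\chi f\|_{L^{p,q}_{2,(\omega)}}$) is finite. All norms take values in $[0,\infty]$, and $0\cdot\infty=0$. Proposition. Let $p,q\in[1,\infty]$, $\omega_0\in\mathscr P(\mathbf R^{4d})$ and $\omega_1,\omega_2\in\mathscr P(\mathbf R^{2d})$. We write points of $\mathbf R^{4d}=\mathbf R^{2d}\times\mathbf R^{2d}$ as $(x,\xi,\eta,y)$, where $(x,\xi)$ is the first (space) variable, $(\eta,y)$ is the second (frequency) variable, and $x,\xi,\eta,y\in\mathbf R^d$. Let $f_1,f_2\in\mathscr S'(\mathbf R^d)$, $\varphi_1,\varphi_2\in\mathscr S(\mathbf R^d)$ and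 $\Psi=V_{\varphi_1}\varphi_2$. Then the following is true. 1. If $\omega_0(x,\xi,\eta,y)\le C\,\omega_1(-x-y,\eta)\,\omega_2(-y,\xi+\eta)$ for all $x,\xi,\eta,y\in\mathbf R^d$ and some constant $C$, then, with the same $C$, $$\|V_\Psi(V_{f_1}f_2)\|_{L^{p,q}_{1,(\omega_0)}}\le C\,\|V_{\varphi_1}f_1\|_{L^{p,q}_{1,(\omega_1)}}\,\|V_{\varphi_2}f_2\|_{L^{q,p}_{2,(\omega_2)}} .$$ 2. If $\omega_1(-x-y,\eta)\,\omega_2(-y,\xi+\eta)\le C\,\omega_0(x,\xi,\eta,y)$ for all $x,\xi,\eta,y\in\mathbf R^d$ and some constant $C$, then, with the same $C$, $$\|V_{\varphi_1}f_1\|_{L^{p,q}_{1,(\omega_1)}}\,\|V_{\varphi_2}f_2\|_{L^{q,p}_{2,(\omega_2)}}\le C\,\|V_\Psi(V_{f_1}f_2)\|_{L^{p,q}_{1,(\omega_0)}} .$$ 3. Suppose that both weight conditions hold, each for some constant. Fix any nonzero Schwartz windows on $\mathbf R^d$, $\mathbf R^d$ and $\mathbf R^{2d}$ (not necessarily related to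 each other) in the definitions of $M^{p,q}_{(\omega_1)}(\mathbf R^d)$, $W^{q,p}_{(\omega_2)}(\mathbf R^d)$ and $M^{p,q}_{(\omega_0)}(\mathbf R^{2d})$. Then, for all $f_1\ne0$ and $f_2\neq 0$ in $\mathscr S'(\mathbf R^d)$, $$f_1\in M^{p,q}_{(\omega_1)}(\mathbf R^d)\ \text{ and }\ f_2\in W^{q,p}_{(\omega_2)}(\mathbf R^d)\iff V_{f_1}f_2\in M^{p,q}_{(\omega_0)}(\mathbf R^{2d}),$$ and there is a constant $C>0$ such that, for all $f_1,f_2\in\mathscr S'(\mathbf R^d)$, $$C^{-1}\|V_{f_1}f_2\|_{M^{p,q}_{(\omega_0)}}\le\|f_1\|_{M^{p,q}_{(\omega_1)}}\|f_2\|_{W^{q,p}_{(\omega_2)}}\le C\,\|V_{f_1}f_2\|_{M^{p,q}_{(\omega_0)}} .$$ -/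

import Mathlib

open MeasureTheory Real
open scoped SchwartzMap ENNReal LineDeriv InnerProductSpace

namespace TF

set_option linter.unusedSectionVars false

section smooth

theorem lip {E F : Type*} [NormedAddCommGroup E] [NormedSpace ℝ E] [NormedAddCommGroup F]
    [NormedSpace ℝ F] (G : 𝓢(E, F)) (k : ℕ) :
    ∃ C : ℝ, 0 ≤ C ∧ ∀ z v w : E, ‖v‖ ≤ 1 → w ∈ segment ℝ z (z + v) →
      ‖z‖ ^ k * ‖G w - G z‖ ≤ C * ‖v‖ := by
  let S := (Finset.Iic (k, 1)).sup (fun m => SchwartzMap.seminorm ℝ m.1 m.2) G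
  have hS : 0 ≤ S := apply_nonneg _ _
  refine ⟨2 ^ k * S, by positivity, fun z v w hv hw => ?_⟩
  have hsub : ∀ y ∈ segment ℝ z (z + v), ‖y - z‖ ≤ ‖v‖ := by
    intro y hy
    obtain ⟨a, b, ha, hb, hab, rfl⟩ := hy
    have : a • z + b • (z + v) - z = b • v := by
      have : a = 1 - b := by linarith
      subst this; module
    rw [this, norm_smul, Real.norm_of_nonneg hb]
    have : b ≤ 1 := by linarith
    nlinarith [norm_nonneg v]
  rcases eq_or_ne (‖z‖ ^ k) 0 with h0 | h0
  · rw [h0]; simp; positivity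
  have hpos : 0 < ‖z‖ ^ k := lt_of_le_of_ne (by positivity) (Ne.symm h0)
  have key : ‖G w - G z‖ ≤ (2 ^ k * S / ‖z‖ ^ k) * ‖w - z‖ := by
    apply (convex_segment z (z + v)).norm_image_sub_le_of_norm_fderiv_le (𝕜 := ℝ)
    · intro y _; exact G.differentiableAt
    · intro y hy
      rw [le_div_iff₀' hpos]
      have h1 : ‖z‖ ≤ 1 + ‖y‖ := by
        have := norm_sub_norm_le z y
        rw [norm_sub_rev] at this
        linarith [hsub y hy]
      have h2 := SchwartzMap.one_add_le_sup_seminorm_apply (𝕜 := ℝ) (m := (k, 1)) (k := k)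
        (n := 1) le_rfl le_rfl G y
      rw [← norm_iteratedFDeriv_fderiv, norm_iteratedFDeriv_zero] at h2
      exact (by gcongr : ‖z‖ ^ k * ‖fderiv ℝ G y‖ ≤ (1 + ‖y‖) ^ k * ‖fderiv ℝ G y‖).trans h2
    · exact left_mem_segment _ _ _
    · exact hw
  calc ‖z‖ ^ k * ‖G w - G z‖ ≤ ‖z‖ ^ k * ((2 ^ k * S / ‖z‖ ^ k) * ‖w - z‖) := by gcongr
    _ = 2 ^ k * S * ‖w - z‖ := by field_simp
    _ ≤ _ := by gcongr; exact hsub w hw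

theorem rem_fderiv {E F : Type*} [NormedAddCommGroup E] [NormedSpace ℝ E] [NormedAddCommGroup F]
    [NormedSpace ℝ F] (G : 𝓢(E, F)) (v : E) :
    fderiv ℝ (fun z => G (z + v) - G z - fderiv ℝ G z v) =
      fun z => SchwartzMap.fderivCLM ℝ E F G (z + v) - SchwartzMap.fderivCLM ℝ E F G z
        - fderiv ℝ (SchwartzMap.fderivCLM ℝ E F G) z v := by
  funext z
  have e : (SchwartzMap.fderivCLM ℝ E F G : E → E →L[ℝ] F) = fderiv ℝ G := by
    funext x; simp
  rw [e]
  have hd : DifferentiableAt ℝ (fderiv ℝ G) z := by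
    rw [← e]; exact (SchwartzMap.fderivCLM ℝ E F G).differentiableAt
  have h1 : HasFDerivAt (fun z => G (z + v)) (fderiv ℝ G (z + v)) z :=
    (hasFDerivAt_comp_add_right v).2 (G.hasFDerivAt (z + v))
  have h2 : HasFDerivAt (fun z => fderiv ℝ G z v) ((fderiv ℝ (fderiv ℝ G) z).flip v) z := by
    simpa using hd.hasFDerivAt.clm_apply (hasFDerivAt_const v z)
  rw [((h1.fun_sub (G.hasFDerivAt z)).fun_sub h2).fderiv]
  congr 1
  ext w
  have hs : IsSymmSndFDerivAt ℝ G z :=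
    (G.smooth 2).contDiffAt.isSymmSndFDerivAt (by simp)
  exact hs.eq w v

theorem rem_bound (n : ℕ) : ∀ {E F : Type} [NormedAddCommGroup E] [NormedSpace ℝ E]
    [NormedAddCommGroup F] [NormedSpace ℝ F] (G : 𝓢(E, F)) (k : ℕ),
    ∃ C : ℝ, 0 ≤ C ∧ ∀ z v : E, ‖v‖ ≤ 1 →
      ‖z‖ ^ k * ‖iteratedFDeriv ℝ n (fun z => G (z + v) - G z - fderiv ℝ G z v) z‖
        ≤ C * ‖v‖ ^ 2 := by
  induction n with
  | zero =>
    intro E F _ _ _ _ G k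
    obtain ⟨C, hC, h⟩ := lip (SchwartzMap.fderivCLM ℝ E F G) k
    refine ⟨C, hC, fun z v hv => ?_⟩
    rw [norm_iteratedFDeriv_zero]
    rcases eq_or_ne (‖z‖ ^ k) 0 with h0 | h0
    · rw [h0]; simp; positivity
    have hpos : 0 < ‖z‖ ^ k := lt_of_le_of_ne (by positivity) (Ne.symm h0)
    have key : ‖G (z + v) - G z - fderiv ℝ G z (z + v - z)‖
        ≤ (C * ‖v‖ / ‖z‖ ^ k) * ‖z + v - z‖ := by
      apply (convex_segment z (z + v)).norm_image_sub_le_of_norm_fderiv_le' (𝕜 := ℝ)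
      · intro y _; exact G.differentiableAt
      · intro y hy
        rw [le_div_iff₀' hpos]
        simpa using h z v y hv hy
      · exact left_mem_segment _ _ _
      · exact right_mem_segment _ _ _
    simp only [add_sub_cancel_left] at key
    calc _ ≤ ‖z‖ ^ k * ((C * ‖v‖ / ‖z‖ ^ k) * ‖v‖) := by gcongr
      _ = _ := by field_simp
  | succ n ih =>
    intro E F _ _ _ _ G k
    obtain ⟨C, hC, h⟩ := ih (SchwartzMap.fderivCLM ℝ E F G) k
    refine ⟨C, hC, fun z v hv => ?_⟩
    rw [← norm_iteratedFDeriv_fderiv, rem_fderiv]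
    exact h z v hv

theorem family_smooth {D S : Type*} [NormedAddCommGroup D] [NormedSpace ℝ D]
    [FiniteDimensional ℝ D] (T : S → D → ℂ) (dd : D → S → S)
    (hd : ∀ s z, ∃ L : D →L[ℝ] ℂ, HasFDerivAt (T s) L z ∧ ∀ v, L v = T (dd v s) z) :
    (∀ s, fderiv ℝ (T s) = fun z => ∑ i, (LinearMap.toContinuousLinearMap
      ((Module.finBasis ℝ D).coord i)).smulRight (T (dd (Module.finBasis ℝ D i) s) z)) ∧
    (∀ n : ℕ, ∀ s, ContDiff ℝ n (T s)) := by
  have h1 : ∀ s, fderiv ℝ (T s) = fun z => ∑ i, (LinearMap.toContinuousLinearMap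
      ((Module.finBasis ℝ D).coord i)).smulRight (T (dd (Module.finBasis ℝ D i) s) z) := by
    intro s
    funext z
    obtain ⟨L, hL, hv⟩ := hd s z
    rw [hL.fderiv]
    ext v
    conv_lhs => rw [← (Module.finBasis ℝ D).sum_repr v]
    rw [map_sum]
    simp only [map_smul]
    simp only [hv]
    simp
  refine ⟨h1, fun n => ?_⟩
  induction n with
  | zero =>
    intro s
    simp only [Nat.cast_zero, contDiff_zero]
    exact continuous_iff_continuousAt.2 fun z => (hd s z).choose_spec.1.continuousAt
  | succ n ih =>
    intro s
    rw [Nat.cast_add, Nat.cast_one, contDiff_succ_iff_fderiv]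
    refine ⟨fun z => (hd s z).choose_spec.1.differentiableAt, by simp, ?_⟩
    rw [h1]
    refine ContDiff.sum fun i _ => ?_
    exact (ContinuousLinearMap.smulRightL ℝ D ℂ (LinearMap.toContinuousLinearMap
      ((Module.finBasis ℝ D).coord i))).contDiff.comp (ih _)

theorem seminorm_sum_apply {ι V : Type*} [AddCommGroup V] [Module ℂ V] (p : ι → Seminorm ℂ V)
    (s : Finset ι) (x : V) : (∑ i ∈ s, p i) x = ∑ i ∈ s, p i x := by
  classical
  induction s using Finset.induction_on with
  | empty => simp
  | insert i s hi ih => rw [Finset.sum_insert hi, Finset.sum_insert hi, add_apply, ih]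

theorem family_bound {D' D : Type*} [NormedAddCommGroup D'] [NormedSpace ℝ D']
    [NormedAddCommGroup D] [NormedSpace ℝ D]
    [FiniteDimensional ℝ D] (T : 𝓢(D', ℂ) → D → ℂ) (dd : D → 𝓢(D', ℂ) →L[ℂ] 𝓢(D', ℂ))
    (hd : ∀ s z, ∃ L : D →L[ℝ] ℂ, HasFDerivAt (T s) L z ∧ ∀ v, L v = T (dd v s) z)
    (hb : ∀ k : ℕ, ∃ q : Seminorm ℂ 𝓢(D', ℂ), Continuous q ∧ ∀ s z, ‖z‖ ^ k * ‖T s z‖ ≤ q s)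
    (n : ℕ) : ∀ k : ℕ, ∃ q : Seminorm ℂ 𝓢(D', ℂ), Continuous q ∧
      ∀ s z, ‖z‖ ^ k * ‖iteratedFDeriv ℝ n (T s) z‖ ≤ q s := by
  obtain ⟨h1, h2⟩ := family_smooth T (fun v s => dd v s) hd
  induction n with
  | zero => intro k; simpa using hb k
  | succ n ih =>
    intro k
    obtain ⟨q, hq, hqb⟩ := ih k
    let b := Module.finBasis ℝ D
    let c : Fin (Module.finrank ℝ D) → (ℂ →L[ℝ] D →L[ℝ] ℂ) := fun i =>
      ContinuousLinearMap.smulRightL ℝ D ℂ (LinearMap.toContinuousLinearMap (b.coord i))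
    refine ⟨∑ i, ‖c i‖₊ • q.comp (dd (b i)).toLinearMap, ?_, fun s z => ?_⟩
    · have : ⇑(∑ i, ‖c i‖₊ • q.comp (dd (b i)).toLinearMap) =
          fun s => ∑ i, ‖c i‖₊ • q (dd (b i) s) := by
        funext s
        rw [seminorm_sum_apply]
        rfl
      rw [this]
      exact continuous_finsetSum _ fun i _ =>
        (hq.comp (dd (b i)).continuous).const_smul _
    · rw [seminorm_sum_apply, ← norm_iteratedFDeriv_fderiv, h1]
      have e : (fun z => ∑ i, (LinearMap.toContinuousLinearMap
          ((Module.finBasis ℝ D).coord i)).smulRight (T (dd (Module.finBasis ℝ D i) s) z))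
          = fun z => ∑ i, (c i ∘ T (dd (b i) s)) z := rfl
      rw [e, iteratedFDeriv_sum (fun i _ => (c i).contDiff.comp (h2 n _))]
      rw [Finset.sum_apply]
      calc _ ≤ ‖z‖ ^ k * ∑ i, ‖c i‖ * ‖iteratedFDeriv ℝ n (T (dd (b i) s)) z‖ := by
            gcongr
            refine (norm_sum_le _ _).trans (Finset.sum_le_sum fun i _ => ?_)
            exact (c i).norm_iteratedFDeriv_comp_left (h2 n _).contDiffAt le_rfl
        _ = ∑ i, ‖c i‖ * (‖z‖ ^ k * ‖iteratedFDeriv ℝ n (T (dd (b i) s)) z‖) := by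
            rw [Finset.mul_sum]; congr 1; ext i; ring
        _ ≤ ∑ i, ‖c i‖ * q (dd (b i) s) := by
            gcongr with i; exact hqb _ _

/-- Assembles a continuous linear operator between Schwartz spaces from a family of functions that
is closed under differentiation and has rapid decay. -/
noncomputable def familyCLM {D' D : Type*} [NormedAddCommGroup D'] [NormedSpace ℝ D']
    [NormedAddCommGroup D] [NormedSpace ℝ D]
    [FiniteDimensional ℝ D] (T : 𝓢(D', ℂ) →ₗ[ℂ] D → ℂ) (dd : D → 𝓢(D', ℂ) →L[ℂ] 𝓢(D', ℂ))
    (hd : ∀ s z, ∃ L : D →L[ℝ] ℂ, HasFDerivAt (T s) L z ∧ ∀ v, L v = T (dd v s) z)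
    (hb : ∀ k : ℕ, ∃ q : Seminorm ℂ 𝓢(D', ℂ), Continuous q ∧ ∀ s z, ‖z‖ ^ k * ‖T s z‖ ≤ q s) :
    𝓢(D', ℂ) →L[ℂ] 𝓢(D, ℂ) :=
  SchwartzMap.mkCLM (fun s => T s) (fun f g x => by simp) (fun a f x => by simp)
    (fun f => contDiff_infty.2 fun n => (family_smooth T (fun v s => dd v s) hd).2 n f)
    (fun m => by
      obtain ⟨q, hq, h⟩ := family_bound T dd hd hb m.2 m.1
      obtain ⟨s, C, -, hC⟩ := Seminorm.bound_of_continuous (schwartz_withSeminorms ℂ D' ℂ) q hq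
      exact ⟨s, C, C.2, fun f x => (h f x).trans (hC f)⟩)

end smooth
section slices

variable {E : Type} [NormedAddCommGroup E] [NormedSpace ℝ E]

/-- The slice `u ↦ G (y, u)` of a Schwartz function on `E × E`. -/
noncomputable def slice (y : E) : 𝓢(E × E, ℂ) →L[ℂ] 𝓢(E, ℂ) :=
  SchwartzMap.compCLM ℂ (g := fun u : E => (y, u))
    (by
      have h : (fun u : E => (y, u)) = fun u => ((y, 0) : E × E) + ContinuousLinearMap.inr ℝ E E u := by
        funext u; simp
      rw [h]
      exact (Function.HasTemperateGrowth.const _).add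
        (ContinuousLinearMap.inr ℝ E E).hasTemperateGrowth)
    ⟨1, 1, fun u => by
      have : ‖u‖ ≤ ‖((y, u) : E × E)‖ := le_max_right _ _
      rw [pow_one]; linarith⟩

@[simp] theorem slice_apply (y : E) (G : 𝓢(E × E, ℂ)) (u : E) : slice y G u = G (y, u) := rfl

theorem norm_iteratedFDeriv_slice_le (f : E × E → ℂ) (hf : ∀ n : ℕ, ContDiff ℝ n f) (y u : E) (n : ℕ) :
    ‖iteratedFDeriv ℝ n (fun u => f (y, u)) u‖ ≤ ‖iteratedFDeriv ℝ n f (y, u)‖ := by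
  have h : (fun u : E => f (y, u))
      = (fun z => f (z + ((y, 0) : E × E))) ∘ ContinuousLinearMap.inr ℝ E E := by
    funext u; simp
  have hc : ContDiff ℝ n (fun z => f (z + ((y, 0) : E × E))) :=
    (hf n).comp (contDiff_id.add contDiff_const)
  rw [h, ContinuousLinearMap.iteratedFDeriv_comp_right _ hc _ le_rfl,
    iteratedFDeriv_comp_add_right]
  have e : (ContinuousLinearMap.inr ℝ E E) u + ((y, 0) : E × E) = (y, u) := by simp
  rw [e]
  refine (ContinuousMultilinearMap.norm_compContinuousLinearMap_le _ _).trans ?_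
  refine mul_le_of_le_one_right (norm_nonneg _) ?_
  refine Finset.prod_le_one (fun _ _ => norm_nonneg _) fun _ _ => ?_
  refine ContinuousLinearMap.opNorm_le_bound _ zero_le_one fun x => ?_
  simp

theorem slice_seminorm_le (k m n : ℕ) (y : E) (G : 𝓢(E × E, ℂ)) :
    ‖y‖ ^ k * SchwartzMap.seminorm ℂ m n (slice y G) ≤ SchwartzMap.seminorm ℂ (k + m) n G := by
  rcases eq_or_ne (‖y‖ ^ k) 0 with h0 | h0
  · rw [h0]; simp
  have hpos : 0 < ‖y‖ ^ k := lt_of_le_of_ne (by positivity) (Ne.symm h0)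
  rw [← le_div_iff₀' hpos]
  refine SchwartzMap.seminorm_le_bound ℂ m n _ (by positivity) fun u => ?_
  rw [le_div_iff₀' hpos]
  have h1 := norm_iteratedFDeriv_slice_le G (fun n => G.smooth n) y u n
  have hy : ‖y‖ ≤ ‖((y, u) : E × E)‖ := le_max_left _ _
  have hu : ‖u‖ ≤ ‖((y, u) : E × E)‖ := le_max_right _ _
  calc ‖y‖ ^ k * (‖u‖ ^ m * ‖iteratedFDeriv ℝ n (slice y G) u‖)
      ≤ ‖((y, u) : E × E)‖ ^ k * (‖((y, u) : E × E)‖ ^ m * ‖iteratedFDeriv ℝ n G (y, u)‖) := by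
        gcongr; exact h1
    _ = ‖((y, u) : E × E)‖ ^ (k + m) * ‖iteratedFDeriv ℝ n G (y, u)‖ := by ring
    _ ≤ _ := SchwartzMap.le_seminorm ℂ _ _ _ _

/-- Weighted slices are controlled uniformly by a continuous seminorm. -/
theorem slice_bound (q : Seminorm ℂ 𝓢(E, ℂ)) (hq : Continuous q) (k : ℕ) :
    ∃ r : Seminorm ℂ 𝓢(E × E, ℂ), Continuous r ∧ ∀ G y, ‖y‖ ^ k * q (slice y G) ≤ r G := by
  obtain ⟨s, C, -, hC⟩ := Seminorm.bound_of_continuous (schwartz_withSeminorms ℂ E ℂ) q hq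
  refine ⟨∑ i ∈ s, C • SchwartzMap.seminorm ℂ (k + i.1) i.2, ?_, fun G y => ?_⟩
  · have : ⇑(∑ i ∈ s, C • SchwartzMap.seminorm ℂ (k + i.1) i.2 : Seminorm ℂ 𝓢(E × E, ℂ)) =
        fun G => ∑ i ∈ s, C • SchwartzMap.seminorm ℂ (k + i.1) i.2 G := by
      funext G
      rw [seminorm_sum_apply]
      rfl
    rw [this]
    exact continuous_finsetSum _ fun i _ =>
      ((schwartz_withSeminorms ℂ (E × E) ℂ).continuous_seminorm (k + i.1, i.2)).const_smul _
  · rw [seminorm_sum_apply]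
    calc ‖y‖ ^ k * q (slice y G)
        ≤ ‖y‖ ^ k * (C * ∑ i ∈ s, SchwartzMap.seminorm ℂ i.1 i.2 (slice y G)) := by
          gcongr
          refine (hC _).trans ?_
          refine mul_le_mul_of_nonneg_left ?_ C.2
          have := Seminorm.finset_sup_le_sum (schwartzSeminormFamily ℂ E ℂ) s (slice y G)
          rw [seminorm_sum_apply] at this
          exact this
      _ = ∑ i ∈ s, C * (‖y‖ ^ k * SchwartzMap.seminorm ℂ i.1 i.2 (slice y G)) := by
          rw [Finset.mul_sum, Finset.mul_sum]; congr 1; ext i; ring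
      _ ≤ ∑ i ∈ s, C * SchwartzMap.seminorm ℂ (k + i.1) i.2 G := by
          gcongr with i; exact slice_seminorm_le _ _ _ _ _

theorem rem_seminorm (q : Seminorm ℂ 𝓢(E, ℂ)) (hq : Continuous q) (G : 𝓢(E × E, ℂ)) :
    ∃ C : ℝ, 0 ≤ C ∧ ∀ y h : E, ‖h‖ ≤ 1 →
      q (slice (y + h) G - slice y G - slice y (LineDeriv.lineDerivOp ((h, 0) : E × E) G))
        ≤ C * ‖h‖ ^ 2 := by
  obtain ⟨s, C, -, hC⟩ := Seminorm.bound_of_continuous (schwartz_withSeminorms ℂ E ℂ) q hq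
  choose B hB hBb using fun i : ℕ × ℕ => rem_bound i.2 G i.1
  refine ⟨C * ∑ i ∈ s, B i, mul_nonneg C.2 (Finset.sum_nonneg fun i _ => hB i), fun y h hh => ?_⟩
  refine (hC _).trans ?_
  have h1 := Seminorm.finset_sup_le_sum (schwartzSeminormFamily ℂ E ℂ) s
    (slice (y + h) G - slice y G - slice y (LineDeriv.lineDerivOp ((h, 0) : E × E) G))
  rw [seminorm_sum_apply] at h1
  have hn : ‖((h, 0) : E × E)‖ = ‖h‖ := by simp [Prod.norm_def]
  have h2 : ∀ i ∈ s, schwartzSeminormFamily ℂ E ℂ i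
      (slice (y + h) G - slice y G - slice y (LineDeriv.lineDerivOp ((h, 0) : E × E) G))
      ≤ B i * ‖h‖ ^ 2 := by
    intro i _
    refine SchwartzMap.seminorm_le_bound ℂ i.1 i.2 _ (by have := hB i; positivity) fun u => ?_
    let f : E × E → ℂ := fun z => G (z + (h, 0)) - G z - fderiv ℝ G z (h, 0)
    have e : ⇑(slice (y + h) G - slice y G
        - slice y (LineDeriv.lineDerivOp ((h, 0) : E × E) G)) = fun u => f (y, u) := by
      funext u
      simp [f, SchwartzMap.lineDerivOp_apply_eq_fderiv]
    have hf : ∀ n : ℕ, ContDiff ℝ n f := by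
      intro n
      have e2 : (fun z => fderiv ℝ G z ((h, 0) : E × E))
          = LineDeriv.lineDerivOp ((h, 0) : E × E) G := by
        funext z; rw [SchwartzMap.lineDerivOp_apply_eq_fderiv]
      refine (((G.smooth n).comp (contDiff_id.add contDiff_const)).sub (G.smooth n)).sub ?_
      rw [e2]
      exact SchwartzMap.smooth _ n
    rw [e]
    have hu : ‖u‖ ≤ ‖((y, u) : E × E)‖ := le_max_right _ _
    have := hBb i (y, u) (h, 0) (by rw [hn]; exact hh)
    rw [hn] at this
    refine le_trans ?_ this
    gcongr
    exact norm_iteratedFDeriv_slice_le f hf y u i.2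
  calc _ ≤ (C : ℝ) * ∑ i ∈ s, B i * ‖h‖ ^ 2 :=
        mul_le_mul_of_nonneg_left (h1.trans (Finset.sum_le_sum h2)) C.2
    _ = _ := by rw [← Finset.sum_mul]; ring

/-- A continuous linear form as a seminorm. -/
noncomputable def absSeminorm (g : 𝓢(E, ℂ) →L[ℂ] ℂ) : Seminorm ℂ 𝓢(E, ℂ) :=
  (normSeminorm ℂ ℂ).comp g.toLinearMap

theorem absSeminorm_continuous (g : 𝓢(E, ℂ) →L[ℂ] ℂ) : Continuous (absSeminorm g) :=
  continuous_norm.comp g.continuous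

variable [FiniteDimensional ℝ E]

/-- Partial application `G ↦ (y ↦ g (G (y, ·)))` of a continuous linear form. -/
noncomputable def partialApply (g : 𝓢(E, ℂ) →L[ℂ] ℂ) : 𝓢(E × E, ℂ) →L[ℂ] 𝓢(E, ℂ) :=
  familyCLM
    { toFun := fun G y => g (slice y G)
      map_add' := fun G H => by funext y; simp
      map_smul' := fun a G => by funext y; simp }
    (fun v => LineDeriv.lineDerivOpCLM ℂ 𝓢(E × E, ℂ) ((v, 0) : E × E))
    (by
      intro G y
      let L : E →ₗ[ℝ] ℂ :=
        { toFun := fun v => g (slice y (LineDeriv.lineDerivOp ((v, 0) : E × E) G))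
          map_add' := fun v w => by
            rw [← map_add, ← map_add]
            congr 2
            ext z
            simp only [SchwartzMap.lineDerivOp_apply_eq_fderiv, add_apply]
            rw [← map_add]; simp
          map_smul' := fun a v => by
            have : LineDeriv.lineDerivOp ((a • v, 0) : E × E) G
                = (a : ℂ) • LineDeriv.lineDerivOp ((v, 0) : E × E) G := by
              ext z
              simp only [SchwartzMap.lineDerivOp_apply_eq_fderiv, smul_apply]
              have : ((a • v, 0) : E × E) = a • (v, 0) := by simp
              rw [this, map_smul]; simp
            rw [this, map_smul, map_smul]; simp }
      refine ⟨LinearMap.toContinuousLinearMap L, ?_, fun v => rfl⟩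
      obtain ⟨C, hC, h⟩ := rem_seminorm (absSeminorm g) (absSeminorm_continuous g) G
      rw [hasFDerivAt_iff_isLittleO_nhds_zero]
      refine Asymptotics.IsBigO.trans_isLittleO (g := fun h : E => ‖h‖ ^ 2) ?_ ?_
      · refine Asymptotics.IsBigO.of_bound C ?_
        filter_upwards [Metric.ball_mem_nhds (0 : E) one_pos] with v hv
        have hv' : ‖v‖ ≤ 1 := by
          rw [mem_ball_zero_iff] at hv; exact hv.le
        have := h y v hv'
        simp only [absSeminorm, Seminorm.comp_apply, ContinuousLinearMap.coe_coe, map_sub] at this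
        simpa [L] using this
      · exact Asymptotics.isLittleO_norm_pow_id one_lt_two)
    (by
      intro k
      obtain ⟨r, hr, h⟩ := slice_bound (absSeminorm g) (absSeminorm_continuous g) k
      exact ⟨r, hr, fun G y => h G y⟩)

@[simp] theorem partialApply_apply (g : 𝓢(E, ℂ) →L[ℂ] ℂ) (G : 𝓢(E × E, ℂ)) (y : E) :
    partialApply g G y = g (slice y G) := rfl

end slices

section fourier

variable {E : Type} [NormedAddCommGroup E] [InnerProductSpace ℝ E] [FiniteDimensional ℝ E]
  [MeasurableSpace E] [BorelSpace E]

/-- The normalization `(2π)^{-n/2}` of the Fourier transform on an `n`-dimensional space. -/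
noncomputable def fourierConst (E : Type) [NormedAddCommGroup E] [InnerProductSpace ℝ E] : ℂ :=
  (((2 * π) ^ (-(Module.finrank ℝ E : ℝ) / 2) : ℝ) : ℂ)

theorem norm_cexp_neg_I (r : ℝ) : ‖Complex.exp (-(Complex.I * r))‖ = 1 := by
  have : -(Complex.I * r) = ((-r : ℝ) : ℂ) * Complex.I := by push_cast; ring
  rw [this, Complex.norm_exp_ofReal_mul_I]

theorem partialFourier_eq (Θ : 𝓢(E × E, ℂ)) (p : E × E) :
    ∫ y, Θ (p.1, y) * Complex.exp (-(Complex.I * (inner ℝ y p.2 : ℝ)))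
      = FourierTransform.fourier (slice p.1 Θ) ((2 * π)⁻¹ • p.2) := by
  rw [SchwartzMap.fourier_coe, Real.fourier_eq']
  congr 1
  funext y
  rw [smul_eq_mul, mul_comm, slice_apply]
  congr 2
  rw [inner_smul_right]
  push_cast
  field_simp

theorem integrable_partialFourier (Θ : 𝓢(E × E, ℂ)) (p : E × E) :
    Integrable (fun y => Θ (p.1, y) * Complex.exp (-(Complex.I * (inner ℝ y p.2 : ℝ)))) := by
  refine ((slice p.1 Θ).integrable (μ := volume)).mono ?_ ?_
  · have h : Continuous fun y => slice p.1 Θ y * Complex.exp (-(Complex.I * (inner ℝ y p.2 : ℝ))) := by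
      fun_prop
    exact h.aestronglyMeasurable
  · refine Filter.Eventually.of_forall fun y => ?_
    rw [norm_mul, norm_cexp_neg_I, mul_one, slice_apply]

theorem partialFourier_bound (k : ℕ) : ∃ q : Seminorm ℂ 𝓢(E × E, ℂ), Continuous q ∧
    ∀ (Θ : 𝓢(E × E, ℂ)) (p : E × E),
    ‖p‖ ^ k * ‖∫ y, Θ (p.1, y) * Complex.exp (-(Complex.I * (inner ℝ y p.2 : ℝ)))‖ ≤ q Θ := by
  have hF : Continuous (FourierTransform.fourierCLM ℂ 𝓢(E, ℂ)) := ContinuousLinearMap.continuous _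
  let F : 𝓢(E, ℂ) →L[ℂ] 𝓢(E, ℂ) := FourierTransform.fourierCLM ℂ 𝓢(E, ℂ)
  have hS : ∀ m : ℕ, Continuous ((SchwartzMap.seminorm ℂ m 0).comp F.toLinearMap) := fun m =>
    ((schwartz_withSeminorms ℂ E ℂ).continuous_seminorm (m, 0)).comp F.continuous
  obtain ⟨q1, hq1, h1⟩ := slice_bound _ (hS 0) k
  obtain ⟨q2, hq2, h2⟩ := slice_bound _ (hS k) 0
  refine ⟨q1 + (Real.toNNReal ((2 * π) ^ k)) • q2, ?_, fun Θ p => ?_⟩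
  · exact hq1.add (hq2.const_smul _)
  · rw [partialFourier_eq]
    set ψ := F (slice p.1 Θ) with hψ
    have e : FourierTransform.fourier (slice p.1 Θ) = ψ := rfl
    rw [e]
    have hx : ‖p.1‖ ^ k * ‖ψ ((2 * π)⁻¹ • p.2)‖ ≤ q1 Θ := by
      refine le_trans ?_ (h1 Θ p.1)
      gcongr
      have := SchwartzMap.norm_pow_mul_le_seminorm ℂ ψ 0 ((2 * π)⁻¹ • p.2)
      simpa using this
    have hy : ‖p.2‖ ^ k * ‖ψ ((2 * π)⁻¹ • p.2)‖ ≤ (2 * π) ^ k * q2 Θ := by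
      have h3 := SchwartzMap.norm_pow_mul_le_seminorm ℂ ψ k ((2 * π)⁻¹ • p.2)
      have h4 := h2 Θ p.1
      rw [pow_zero, one_mul] at h4
      have h5 := h3.trans h4
      rw [norm_smul, mul_pow, norm_inv, inv_pow, Real.norm_of_nonneg (by positivity)] at h5
      rw [← div_le_iff₀' (by positivity)]
      refine le_trans (le_of_eq ?_) h5
      field_simp
    have hp : ‖p‖ ^ k ≤ ‖p.1‖ ^ k + ‖p.2‖ ^ k := by
      rw [Prod.norm_def]
      rcases max_choice ‖p.1‖ ‖p.2‖ with h | h <;> rw [h]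
      · linarith [pow_nonneg (norm_nonneg p.2) k]
      · linarith [pow_nonneg (norm_nonneg p.1) k]
    calc _ ≤ (‖p.1‖ ^ k + ‖p.2‖ ^ k) * ‖ψ ((2 * π)⁻¹ • p.2)‖ := by gcongr
      _ ≤ q1 Θ + (2 * π) ^ k * q2 Θ := by rw [add_mul]; exact add_le_add hx hy
      _ = q1 Θ + (Real.toNNReal ((2 * π) ^ k) : ℝ) * q2 Θ := by
          rw [Real.coe_toNNReal _ (by positivity)]
      _ = _ := rfl

theorem temperate_inner_snd (w : E) :
    Function.HasTemperateGrowth (fun p : E × E => -(Complex.I * (inner ℝ p.2 w : ℝ))) := by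
  have : (fun p : E × E => -(Complex.I * (inner ℝ p.2 w : ℝ)))
      = ((-Complex.I) • (Complex.ofRealCLM.comp ((innerSL ℝ w).comp (ContinuousLinearMap.snd ℝ E E)))
          : E × E →L[ℝ] ℂ) := by
    funext p
    simp [real_inner_comm]
  rw [this]
  exact ContinuousLinearMap.hasTemperateGrowth _

/-- The operator on test functions that becomes the derivative in direction `v` after a partial
Fourier transform. -/
noncomputable def partialFourierDeriv (v : E × E) : 𝓢(E × E, ℂ) →L[ℂ] 𝓢(E × E, ℂ) :=
  LineDeriv.lineDerivOpCLM ℂ 𝓢(E × E, ℂ) ((v.1, 0) : E × E) +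
    SchwartzMap.smulLeftCLM ℂ (fun p : E × E => -(Complex.I * (inner ℝ p.2 v.2 : ℝ)))

theorem partialFourierDeriv_apply (v : E × E) (Θ : 𝓢(E × E, ℂ)) (p : E × E) :
    partialFourierDeriv v Θ p
      = fderiv ℝ Θ p (v.1, 0) + -(Complex.I * (inner ℝ p.2 v.2 : ℝ)) * Θ p := by
  simp only [partialFourierDeriv, add_apply,
    LineDeriv.lineDerivOpCLM_apply, SchwartzMap.lineDerivOp_apply_eq_fderiv]
  rw [SchwartzMap.smulLeftCLM_apply_apply (temperate_inner_snd v.2)]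
  rfl

set_option maxSynthPendingDepth 3 in
theorem partialFourier_hasFDerivAt (Θ : 𝓢(E × E, ℂ)) (p : E × E) :
    ∃ L : E × E →L[ℝ] ℂ, HasFDerivAt (fun p : E × E =>
      ∫ y, Θ (p.1, y) * Complex.exp (-(Complex.I * (inner ℝ y p.2 : ℝ)))) L p ∧
      ∀ v, L v = ∫ y, partialFourierDeriv v Θ (p.1, y)
        * Complex.exp (-(Complex.I * (inner ℝ y p.2 : ℝ))) := by
  let ι₁ : E × E →L[ℝ] E × E :=
    (ContinuousLinearMap.inl ℝ E E).comp (ContinuousLinearMap.fst ℝ E E)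
  let m : E → E × E →L[ℝ] ℂ := fun y =>
    (-Complex.I) • (Complex.ofRealCLM.comp ((innerSL ℝ y).comp (ContinuousLinearMap.snd ℝ E E)))
  have hm : ∀ y v, m y v = -(Complex.I * (inner ℝ y v.2 : ℝ)) := fun y v => by simp [m]
  let ex : E × E → E → ℂ := fun p y => Complex.exp (-(Complex.I * (inner ℝ y p.2 : ℝ)))
  have hex : ∀ p y, ‖ex p y‖ = 1 := fun p y => norm_cexp_neg_I _
  let F' : E × E → E → E × E →L[ℝ] ℂ := fun p y =>
    Θ (p.1, y) • (ex p y • m y) + ex p y • ((fderiv ℝ Θ (p.1, y)).comp ι₁)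
  have hι : ‖ι₁‖ ≤ 1 := by
    refine ContinuousLinearMap.opNorm_le_bound _ zero_le_one fun v => ?_
    simp [ι₁, Prod.norm_def]
  have hmn : ∀ y, ‖m y‖ ≤ ‖y‖ := by
    intro y
    refine ContinuousLinearMap.opNorm_le_bound _ (norm_nonneg _) fun v => ?_
    rw [hm, norm_neg, norm_mul, Complex.norm_I, one_mul, Complex.norm_real]
    refine (norm_inner_le_norm _ _).trans ?_
    gcongr
    exact le_max_right _ _
  let N := (volume : Measure E).integrablePower
  let C1 := 2 ^ N * (Finset.Iic (N, 1)).sup (fun m => SchwartzMap.seminorm ℝ m.1 m.2) Θ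
  let C2 := 2 ^ (N + 1) * (Finset.Iic (N + 1, 0)).sup (fun m => SchwartzMap.seminorm ℝ m.1 m.2) Θ
  have hF'n : ∀ p y, ‖F' p y‖ ≤ (C1 + C2) * (1 + ‖y‖) ^ (-(N : ℝ)) := by
    intro p y
    have hy : ‖y‖ ≤ ‖((p.1, y) : E × E)‖ := le_max_right _ _
    have h1 := SchwartzMap.one_add_le_sup_seminorm_apply (𝕜 := ℝ) (m := (N, 1)) (k := N)
      (n := 1) le_rfl le_rfl Θ (p.1, y)
    rw [← norm_iteratedFDeriv_fderiv, norm_iteratedFDeriv_zero] at h1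
    have h2 := SchwartzMap.one_add_le_sup_seminorm_apply (𝕜 := ℝ) (m := (N + 1, 0)) (k := N + 1)
      (n := 0) le_rfl le_rfl Θ (p.1, y)
    rw [norm_iteratedFDeriv_zero] at h2
    have hpos : 0 < (1 + ‖y‖) ^ N := by positivity
    rw [Real.rpow_neg (by positivity), Real.rpow_natCast, ← div_eq_mul_inv, le_div_iff₀' hpos]
    have h3 : ‖F' p y‖ ≤ ‖Θ (p.1, y)‖ * (1 + ‖y‖) + ‖fderiv ℝ Θ (p.1, y)‖ := by
      refine (norm_add_le _ _).trans ?_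
      have a1 : ‖Θ (p.1, y) • (ex p y • m y)‖ = ‖Θ (p.1, y)‖ * ‖m y‖ := by
        rw [norm_smul, norm_smul (ex p y), hex, one_mul]
      rw [a1, norm_smul (ex p y), hex, one_mul]
      gcongr
      · linarith [hmn y]
      · exact (ContinuousLinearMap.opNorm_comp_le _ _).trans
          (mul_le_of_le_one_right (norm_nonneg _) hι)
    calc _ ≤ (1 + ‖y‖) ^ N * (‖Θ (p.1, y)‖ * (1 + ‖y‖) + ‖fderiv ℝ Θ (p.1, y)‖) := by gcongr
      _ = (1 + ‖y‖) ^ N * ‖fderiv ℝ Θ (p.1, y)‖ + (1 + ‖y‖) ^ (N + 1) * ‖Θ (p.1, y)‖ := by ring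
      _ ≤ (1 + ‖((p.1, y) : E × E)‖) ^ N * ‖fderiv ℝ Θ (p.1, y)‖
          + (1 + ‖((p.1, y) : E × E)‖) ^ (N + 1) * ‖Θ (p.1, y)‖ := by gcongr
      _ ≤ _ := add_le_add h1 h2
  have hbi : Integrable (fun y : E => (C1 + C2) * (1 + ‖y‖) ^ (-(N : ℝ))) :=
    (Measure.integrable_pow_neg_integrablePower (volume : Measure E)).const_mul _
  have hcm : Continuous m := by
    simp only [m]; fun_prop
  have hcf : Continuous (fderiv ℝ Θ) := (Θ.smooth 1).continuous_fderiv one_ne_zero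
  have hcF' : Continuous (F' p) := by
    have hce : Continuous (ex p) := by simp only [ex]; fun_prop
    have hcy : Continuous fun y : E => (p.1, y) := by fun_prop
    exact ((Θ.continuous.comp hcy).smul (hce.smul hcm)).add
      (hce.smul ((hcf.comp hcy).clm_comp continuous_const))
  have hint : Integrable (F' p) := hbi.mono' hcF'.aestronglyMeasurable
    (Filter.Eventually.of_forall fun y => hF'n p y)
  refine ⟨∫ y, F' p y, ?_, fun v => ?_⟩
  · refine hasFDerivAt_integral_of_dominated_of_fderiv_le (s := Set.univ) Filter.univ_mem
      (Filter.Eventually.of_forall fun p => (integrable_partialFourier Θ p).aestronglyMeasurable)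
      (integrable_partialFourier Θ p) hcF'.aestronglyMeasurable
      (Filter.Eventually.of_forall fun y p _ => hF'n p y) hbi
      (Filter.Eventually.of_forall fun y p _ => ?_)
    have e1 : HasFDerivAt (fun p : E × E => Θ (p.1, y)) ((fderiv ℝ Θ (p.1, y)).comp ι₁) p := by
      have h1 : HasFDerivAt (fun p : E × E => (p.1, y)) ι₁ p := by
        have : (fun p : E × E => (p.1, y)) = fun p => ι₁ p + ((0, y) : E × E) := by
          funext p; simp [ι₁]
        rw [this]
        exact ι₁.hasFDerivAt.add_const _
      exact HasFDerivAt.comp p (Θ.hasFDerivAt (p.1, y)) h1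
    have e2 : HasFDerivAt (fun p : E × E => ex p y) (ex p y • m y) p := by
      have h1 : (fun p : E × E => ex p y) = fun p => Complex.exp (m y p) := by
        funext p; rw [hm]
      have h2 := (m y).hasFDerivAt (x := p) |>.cexp
      rw [h1]
      rw [hm] at h2
      exact h2
    exact e1.mul e2
  · rw [ContinuousLinearMap.integral_apply hint]
    congr 1
    funext y
    rw [partialFourierDeriv_apply]
    simp only [F', add_apply, smul_apply, smul_eq_mul,
      ContinuousLinearMap.comp_apply, hm, ex]
    have : ι₁ v = (v.1, 0) := by simp [ι₁]
    rw [this]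
    ring

/-- The partial Fourier transform `(x, ξ) ↦ (2π)^{-n/2} ∫ Θ (x, y) e^{-i⟨y, ξ⟩} dy` in the second
variable, as a continuous linear operator on Schwartz functions. -/
noncomputable def partialFourier : 𝓢(E × E, ℂ) →L[ℂ] 𝓢(E × E, ℂ) :=
  fourierConst E • familyCLM
    { toFun := fun Θ p => ∫ y, Θ (p.1, y) * Complex.exp (-(Complex.I * (inner ℝ y p.2 : ℝ)))
      map_add' := fun Θ Η => by
        funext p
        simp only [add_apply, add_mul, Pi.add_apply]
        exact integral_add (integrable_partialFourier Θ p) (integrable_partialFourier Η p)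
      map_smul' := fun a Θ => by
        funext p
        simp only [smul_apply, smul_eq_mul, mul_assoc, Pi.smul_apply, RingHom.id_apply]
        exact integral_const_mul _ _ }
    partialFourierDeriv partialFourier_hasFDerivAt partialFourier_bound

theorem partialFourier_apply (Θ : 𝓢(E × E, ℂ)) (x ξ : E) :
    partialFourier Θ (x, ξ)
      = fourierConst E * ∫ y, Θ (x, y) * Complex.exp (-(Complex.I * (inner ℝ y ξ : ℝ))) := rfl

end fourier

section tensor

variable {E : Type} [NormedAddCommGroup E] [NormedSpace ℝ E]

theorem norm_iteratedFDeriv_comp_clm_le {D : Type} [NormedAddCommGroup D] [NormedSpace ℝ D]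
    (L : D →L[ℝ] E) (hL : ‖L‖ ≤ 1) (f : 𝓢(E, ℂ)) (n : ℕ) (z : D) :
    ‖iteratedFDeriv ℝ n (fun z => f (L z)) z‖ ≤ ‖iteratedFDeriv ℝ n f (L z)‖ := by
  have h := L.iteratedFDeriv_comp_right (f.smooth n) z le_rfl
  have e : (fun z => f (L z)) = f ∘ L := rfl
  rw [e, h]
  refine (ContinuousMultilinearMap.norm_compContinuousLinearMap_le _ _).trans ?_
  exact mul_le_of_le_one_right (norm_nonneg _)
    (Finset.prod_le_one (fun _ _ => norm_nonneg _) fun _ _ => hL)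

/-- The tensor product `(y, u) ↦ f y * g u` of two Schwartz functions. -/
noncomputable def tensor (f g : 𝓢(E, ℂ)) : 𝓢(E × E, ℂ) where
  toFun p := f p.1 * g p.2
  smooth' := ((f.smooth ⊤).comp contDiff_fst).mul ((g.smooth ⊤).comp contDiff_snd)
  decay' := by
    intro k n
    let sf := fun a b => SchwartzMap.seminorm ℝ a b f
    let sg := fun a b => SchwartzMap.seminorm ℝ a b g
    refine ⟨∑ i ∈ Finset.range (n + 1), (n.choose i : ℝ) *
      (sf k i * sg 0 (n - i) + sf 0 i * sg k (n - i)), fun z => ?_⟩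
    have h1 : ContDiff ℝ n fun p : E × E => f p.1 := (f.smooth n).comp contDiff_fst
    have h2 : ContDiff ℝ n fun p : E × E => g p.2 := (g.smooth n).comp contDiff_snd
    have h := norm_iteratedFDeriv_mul_le h1 h2 z (n := n) le_rfl
    refine (mul_le_mul_of_nonneg_left h (by positivity)).trans ?_
    rw [Finset.mul_sum]
    refine Finset.sum_le_sum fun i _ => ?_
    have hf := norm_iteratedFDeriv_comp_clm_le (ContinuousLinearMap.fst ℝ E E)
      (ContinuousLinearMap.norm_fst_le ℝ E E) f i z
    have hg := norm_iteratedFDeriv_comp_clm_le (ContinuousLinearMap.snd ℝ E E)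
      (ContinuousLinearMap.norm_snd_le ℝ E E) g (n - i) z
    simp only [ContinuousLinearMap.coe_fst', ContinuousLinearMap.coe_snd'] at hf hg
    have hz : ‖z‖ ^ k ≤ ‖z.1‖ ^ k + ‖z.2‖ ^ k := by
      rw [Prod.norm_def]
      rcases max_choice ‖z.1‖ ‖z.2‖ with h | h <;> rw [h]
      · linarith [pow_nonneg (norm_nonneg z.2) k]
      · linarith [pow_nonneg (norm_nonneg z.1) k]
    have b1 := SchwartzMap.le_seminorm ℝ k i f z.1
    have b2 := SchwartzMap.norm_iteratedFDeriv_le_seminorm ℝ f i z.1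
    have b3 := SchwartzMap.le_seminorm ℝ k (n - i) g z.2
    have b4 := SchwartzMap.norm_iteratedFDeriv_le_seminorm ℝ g (n - i) z.2
    calc ‖z‖ ^ k * ((n.choose i : ℝ) * ‖iteratedFDeriv ℝ i (fun p : E × E => f p.1) z‖
          * ‖iteratedFDeriv ℝ (n - i) (fun p : E × E => g p.2) z‖)
        ≤ (‖z.1‖ ^ k + ‖z.2‖ ^ k) * ((n.choose i : ℝ) * ‖iteratedFDeriv ℝ i f z.1‖
          * ‖iteratedFDeriv ℝ (n - i) g z.2‖) := by gcongr
      _ = (n.choose i : ℝ) * ((‖z.1‖ ^ k * ‖iteratedFDeriv ℝ i f z.1‖)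
            * ‖iteratedFDeriv ℝ (n - i) g z.2‖
          + ‖iteratedFDeriv ℝ i f z.1‖
            * (‖z.2‖ ^ k * ‖iteratedFDeriv ℝ (n - i) g z.2‖)) := by ring
      _ ≤ _ := by
        have : 0 ≤ sf k i := apply_nonneg _ _
        have : 0 ≤ sf 0 i := apply_nonneg _ _
        gcongr

@[simp] theorem tensor_apply (f g : 𝓢(E, ℂ)) (p : E × E) : tensor f g p = f p.1 * g p.2 := rfl

/-- Pointwise complex conjugation of a Schwartz function. -/
noncomputable def conjS (f : 𝓢(E, ℂ)) : 𝓢(E, ℂ) :=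
  SchwartzMap.postcompCLM (𝕜 := ℝ) (Complex.conjCLE : ℂ →L[ℝ] ℂ) f

@[simp] theorem conjS_apply (f : 𝓢(E, ℂ)) (x : E) : conjS f x = starRingEnd ℂ (f x) := rfl

/-- The complex conjugate `ψ ↦ conj (f (conj ψ))` of a tempered distribution. -/
noncomputable def conjDist (f : 𝓢'(E, ℂ)) : 𝓢(E, ℂ) →L[ℂ] ℂ where
  toFun ψ := starRingEnd ℂ (f (conjS ψ))
  map_add' φ ψ := by
    have : conjS (φ + ψ) = conjS φ + conjS ψ := by ext x; simp
    rw [this, map_add, map_add]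
  map_smul' a ψ := by
    have : conjS (a • ψ) = starRingEnd ℂ a • conjS ψ := by ext x; simp
    rw [this, map_smul]; simp
  cont := by
    have h1 : Continuous (fun ψ : 𝓢(E, ℂ) => conjS ψ) :=
      (SchwartzMap.postcompCLM (𝕜 := ℝ) (Complex.conjCLE : ℂ →L[ℝ] ℂ)).continuous
    exact Complex.continuous_conj.comp (f.cont.comp h1)

end tensor

section stft

variable {E : Type} [NormedAddCommGroup E] [InnerProductSpace ℝ E] [FiniteDimensional ℝ E]
  [MeasurableSpace E] [BorelSpace E]

theorem temperate_modulation (ξ : E) :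
    Function.HasTemperateGrowth fun y : E => Complex.exp (-(Complex.I * (inner ℝ y ξ : ℝ))) := by
  let l : E →L[ℝ] ℂ := (-Complex.I) • (Complex.ofRealCLM.comp (innerSL ℝ ξ))
  have hl : ∀ y, l y = -(Complex.I * (inner ℝ y ξ : ℝ)) := fun y => by
    simp [l, real_inner_comm]
  let f : E → ℂ := fun y => Complex.exp (l y)
  have hf : (fun y : E => Complex.exp (-(Complex.I * (inner ℝ y ξ : ℝ)))) = f := by
    funext y; simp only [f, hl]
  have hs : ContDiff ℝ ((⊤ : ℕ∞) : WithTop ℕ∞) f := l.contDiff.cexp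
  let c : ℂ →L[ℝ] E →L[ℝ] ℂ := (ContinuousLinearMap.lsmul ℝ ℂ :
    ℂ →L[ℝ] (E →L[ℝ] ℂ) →L[ℝ] (E →L[ℝ] ℂ)).flip l
  have hfd : fderiv ℝ f = c ∘ f := by
    funext y
    rw [(l.hasFDerivAt (x := y)).cexp.fderiv]
    ext v
    simp [c, f]
  have hb : ∀ n : ℕ, ∀ y, ‖iteratedFDeriv ℝ n f y‖ ≤ ‖c‖ ^ n := by
    intro n
    induction n with
    | zero =>
      intro y
      rw [norm_iteratedFDeriv_zero, pow_zero]
      simp only [f, hl]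
      rw [norm_cexp_neg_I]
    | succ n ih =>
      intro y
      rw [← norm_iteratedFDeriv_fderiv, hfd]
      refine (c.norm_iteratedFDeriv_comp_left (hs.contDiffAt (x := y)) (n := n)
        (mod_cast le_top)).trans ?_
      rw [pow_succ']
      gcongr
      exact ih y
  rw [hf]
  refine ⟨hs, fun n => ⟨0, ‖c‖ ^ n, fun y => ?_⟩⟩
  simpa using hb n y

/-- The Schwartz function `y ↦ conj (φ (y - x)) e^{-i⟨y, ξ⟩}`. -/
noncomputable def stftAtom (φ : 𝓢(E, ℂ)) (x ξ : E) : 𝓢(E, ℂ) :=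
  SchwartzMap.smulLeftCLM ℂ (fun y : E => Complex.exp (-(Complex.I * (inner ℝ y ξ : ℝ))))
    (SchwartzMap.compSubConstCLM ℂ x (conjS φ))

theorem stftAtom_apply (φ : 𝓢(E, ℂ)) (x ξ y : E) :
    stftAtom φ x ξ y
      = Complex.exp (-(Complex.I * (inner ℝ y ξ : ℝ))) * starRingEnd ℂ (φ (y - x)) := by
  rw [stftAtom, SchwartzMap.smulLeftCLM_apply_apply (temperate_modulation ξ)]
  rfl

/-- The short-time Fourier transform `V_φ f` of a tempered distribution `f` with a Schwartz window
`φ`. It is the function `(x, ξ) ↦ (2π)^{-n/2} ⟨f, conj (φ (· - x)) e^{-i⟨·, ξ⟩}⟩`. -/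
noncomputable def stft (φ : 𝓢(E, ℂ)) (f : 𝓢'(E, ℂ)) (p : E × E) : ℂ :=
  fourierConst E * f (stftAtom φ p.1 p.2)

/-- The linear change of variables `(x, y) ↦ (y, y - x)`. -/
noncomputable def shear (E : Type) [NormedAddCommGroup E] [NormedSpace ℝ E] :
    (E × E) ≃L[ℝ] (E × E) where
  toFun p := (p.2, p.2 - p.1)
  invFun p := (p.1 - p.2, p.1)
  map_add' p q := by ext <;> simp; abel
  map_smul' a p := by ext <;> simp [smul_sub]
  left_inv p := by ext <;> simp
  right_inv p := by ext <;> simp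
  continuous_toFun := by fun_prop
  continuous_invFun := by fun_prop

/-- The identification of the Euclidean space `E × E` (with the `ℓ²` norm) with the product. -/
noncomputable def prodEquiv (E : Type) [NormedAddCommGroup E] [NormedSpace ℝ E] :
    WithLp 2 (E × E) ≃L[ℝ] E × E := WithLp.prodContinuousLinearEquiv 2 ℝ E E

/-- The short-time Fourier transform `V_φ f` of two Schwartz functions, as a Schwartz function on
phase space: the partial Fourier transform, in the second variable, of
`(x, y) ↦ f y * conj (φ (y - x))`. -/
noncomputable def schwartzSTFT (φ f : 𝓢(E, ℂ)) : 𝓢(WithLp 2 (E × E), ℂ) :=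
  SchwartzMap.compCLMOfContinuousLinearEquiv ℂ (prodEquiv E)
    (partialFourier
      (SchwartzMap.compCLMOfContinuousLinearEquiv ℂ (shear E) (tensor f (conjS φ))))

theorem schwartzSTFT_apply (φ f : 𝓢(E, ℂ)) (x ξ : E) :
    schwartzSTFT φ f (WithLp.toLp 2 (x, ξ)) = fourierConst E *
      ∫ y, f y * starRingEnd ℂ (φ (y - x)) * Complex.exp (-(Complex.I * (inner ℝ y ξ : ℝ))) :=
  rfl

/-- The short-time Fourier transform `V_φ f` of a tempered distribution `f` with a tempered
distribution `φ` as window. It is the tempered distribution on phase space given by the partial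
Fourier transform, in the second variable, of the distribution `f(y) conj(φ(y - x))`. By
transposition, a test function `Θ(x, ξ)` is first mapped to its partial Fourier transform
`Θ'(x, y)`, the variables are changed by `(x, y) = (y - u, y)`, and the tensor product of `f` (acting
on `y`) and the conjugate of `φ` (acting on `u`) is applied. -/
noncomputable def distSTFT (φ f : 𝓢'(E, ℂ)) : 𝓢'(WithLp 2 (E × E), ℂ) :=
  PointwiseConvergenceCLM.precomp ℂ
    (partialApply (conjDist φ) ∘L
      SchwartzMap.compCLMOfContinuousLinearEquiv ℂ (shear E).symm ∘L
      partialFourier ∘L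
      SchwartzMap.compCLMOfContinuousLinearEquiv ℂ (prodEquiv E).symm) f

theorem distSTFT_apply (φ f : 𝓢'(E, ℂ)) (Θ : 𝓢(WithLp 2 (E × E), ℂ)) :
    distSTFT φ f Θ = f (partialApply (conjDist φ)
      (SchwartzMap.compCLMOfContinuousLinearEquiv ℂ (shear E).symm
        (partialFourier (SchwartzMap.compCLMOfContinuousLinearEquiv ℂ (prodEquiv E).symm Θ)))) :=
  rfl

end stft

section spaces

/-- The class `𝒫` of polynomially moderate weights: positive measurable functions `ω` with
`ω (x + y) ≤ ω x * v y` for some polynomially growing `v`. A function is bounded above by a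
polynomial exactly when it is bounded by some `C * (1 + ‖y‖) ^ N`. -/
structure PolyModerate {X : Type} [NormedAddCommGroup X] [MeasurableSpace X] (ω : X → ℝ) : Prop where
  measurable : Measurable ω
  pos : ∀ x, 0 < ω x
  moderate : ∃ (C : ℝ) (N : ℕ), ∀ x y, ω (x + y) ≤ C * ω x * (1 + ‖y‖) ^ N

/-- The extended norm of `L^{p,q}_{1,(ω)}`: first the `L^p` norm in `x`, then the `L^q` norm in
`ξ`. -/
noncomputable def mixedNorm₁ {X : Type} [MeasureSpace X] (p q : ℝ≥0∞) (ω : X × X → ℝ)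
    (F : X × X → ℂ) : ℝ≥0∞ :=
  eLpNorm (fun ξ : X => eLpNorm (fun x : X => F (x, ξ) * (ω (x, ξ) : ℂ)) p volume) q volume

/-- The extended norm of `L^{p,q}_{2,(ω)}`: first the `L^q` norm in `ξ`, then the `L^p` norm in
`x`. -/
noncomputable def mixedNorm₂ {X : Type} [MeasureSpace X] (p q : ℝ≥0∞) (ω : X × X → ℝ)
    (F : X × X → ℂ) : ℝ≥0∞ :=
  eLpNorm (fun x : X => eLpNorm (fun ξ : X => F (x, ξ) * (ω (x, ξ) : ℂ)) q volume) p volume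

variable {E : Type} [NormedAddCommGroup E] [InnerProductSpace ℝ E] [FiniteDimensional ℝ E]
  [MeasurableSpace E] [BorelSpace E]

/-- The extended norm `‖V_φ f‖_{L^{p,q}_{1,(ω)}}` of `M^{p,q}_{(ω)}` with respect to the
window `φ`. -/
noncomputable def modNorm (p q : ℝ≥0∞) (ω : E × E → ℝ) (φ : 𝓢(E, ℂ)) (f : 𝓢'(E, ℂ)) : ℝ≥0∞ :=
  mixedNorm₁ p q ω (stft φ f)

/-- The extended norm `‖V_φ f‖_{L^{p,q}_{2,(ω)}}` of `W^{p,q}_{(ω)}` with respect to the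
window `φ`. -/
noncomputable def wienerNorm (p q : ℝ≥0∞) (ω : E × E → ℝ) (φ : 𝓢(E, ℂ)) (f : 𝓢'(E, ℂ)) : ℝ≥0∞ :=
  mixedNorm₂ p q ω (stft φ f)

/-- The modulation space `M^{p,q}_{(ω)}`, defined with the window `φ`. -/
def modSpace (p q : ℝ≥0∞) (ω : E × E → ℝ) (φ : 𝓢(E, ℂ)) : Set 𝓢'(E, ℂ) :=
  {f | modNorm p q ω φ f < ∞}

/-- The modulation space `W^{p,q}_{(ω)}`, defined with the window `φ`. -/
def wienerSpace (p q : ℝ≥0∞) (ω : E × E → ℝ) (φ : 𝓢(E, ℂ)) : Set 𝓢'(E, ℂ) :=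
  {f | wienerNorm p q ω φ f < ∞}

/-- The space `ℝ^d`. -/
abbrev Rd (d : ℕ) : Type := EuclideanSpace ℝ (Fin d)

/-- The space `ℝ^{2d} = ℝ^d × ℝ^d` with its Euclidean structure. -/
abbrev R2d (d : ℕ) : Type := WithLp 2 (Rd d × Rd d)

/-- The point `(x, ξ)` of `ℝ^{2d}`. -/
abbrev pt {d : ℕ} (x ξ : Rd d) : R2d d := WithLp.toLp 2 (x, ξ)

end spaces

end TF

/-! The core is a pointwise identity, `norm_stft_schwartzSTFT_distSTFT`: for Ψ = V_{φ₁}φ₂, the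
modulus of V_Ψ(V_{f₁}f₂) at (x, ξ, η, y) equals |V_{φ₁}f₁(-x-y, η)| · |V_{φ₂}f₂(-y, ξ+η)|. Indeed
V_{f₁}f₂ is a partial Fourier transform of a sheared tensor product of f₂ and conj f₁. Transposing
these operations onto a time-frequency shift of conj Ψ undoes the partial Fourier transform inside Ψ
and leaves, up to a unimodular factor, a tensor product of an atom for f₂ and a conjugated atom for
f₁.

The mixed norm of such a product factorizes (`mixedLpNorm_tensor`): at fixed (η, y), translations
and a reflection decouple the two inner variables, and what remains is a product in η and y. The
first factor is integrated in space and then in frequency, the second in frequency and then in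
space, hence M^{p,q} for f₁ and W^{q,p} for f₂. The product of the two norms is therefore exactly a
norm of V_Ψ(V_{f₁}f₂) with weight ω₁(-x-y, η) ω₂(-y, ξ+η) (`mixedNorm_mul_eq`), and (1) and (2)
follow by comparing weights.

For (3), the choice Ψ = V_{χ₁}χ₂ leaves only the change of window from Ψ to Φ on phase space. A
reproducing formula recovers f from V_φ f (`reproducing_formula`), so |V_χ f| is dominated by the
convolution of |V_φ f| with a Schwartz kernel. Moderateness of the weight and Young's inequality for
mixed norms turn this into a norm estimate (`modNorm_le_mul_modNorm`). The formula also shows that a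
nonzero distribution has nonzero norm, so finiteness of the product is finiteness of both factors.

The analytic point in the reproducing formula is that a tempered distribution may be moved inside an
integral of test functions (`apply_eq_integral_sect`). The distribution is factored through a Banach
space, where the Bochner integral applies. -/

namespace TF

set_option linter.unusedSectionVars false

/-! ### Lebesgue norms of [0, ∞]-valued functions and Minkowski's integral inequality -/

section lebesgue

variable {α β : Type*} [MeasurableSpace α] [MeasurableSpace β] {μ : Measure α} {ν : Measure β}

theorem eLpNorm_top_eq_essSup (f : α → ℝ≥0∞) : eLpNorm f ∞ μ = essSup f μ := by
  simp [eLpNorm_exponent_top, eLpNormEssSup_eq_essSup_enorm]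

theorem eLpNorm_ennreal_eq {p : ℝ≥0∞} (h0 : p ≠ 0) (ht : p ≠ ∞) (f : α → ℝ≥0∞) :
    eLpNorm f p μ = (∫⁻ x, f x ^ p.toReal ∂μ) ^ (1 / p.toReal) := by
  simp [eLpNorm_eq_lintegral_rpow_enorm_toReal h0 ht]

theorem eLpNorm_ennreal_const_mul (a : ℝ≥0∞) (p : ℝ≥0∞) {f : α → ℝ≥0∞} (hf : Measurable f) :
    eLpNorm (fun x => a * f x) p μ = a * eLpNorm f p μ := by
  rcases eq_or_ne p 0 with rfl | h0
  · simp
  rcases eq_or_ne p ∞ with rfl | ht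
  · simp only [eLpNorm_top_eq_essSup, ENNReal.essSup_const_mul]
  have hp : 0 < p.toReal := ENNReal.toReal_pos h0 ht
  rw [eLpNorm_ennreal_eq h0 ht, eLpNorm_ennreal_eq h0 ht]
  simp only [ENNReal.mul_rpow_of_nonneg _ _ hp.le]
  rw [lintegral_const_mul _ (hf.pow_const _), ENNReal.mul_rpow_of_nonneg _ _ (by positivity),
    ← ENNReal.rpow_mul, mul_one_div_cancel hp.ne', ENNReal.rpow_one]

/-- Tonelli when p is finite. For p = ∞ the lower bound is obtained by slicing: for almost every x,
the product is at most its essential supremum for almost every y, and the constant factors are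
pulled out of the two essential suprema one at a time. -/
theorem eLpNorm_prod_mul [SFinite μ] [SFinite ν] (p : ℝ≥0∞) {f : α → ℝ≥0∞} {g : β → ℝ≥0∞}
    (hf : Measurable f) (hg : Measurable g) :
    eLpNorm (fun z : α × β => f z.1 * g z.2) p (μ.prod ν) = eLpNorm f p μ * eLpNorm g p ν := by
  rcases eq_or_ne p 0 with rfl | h0
  · simp
  rcases eq_or_ne p ∞ with rfl | ht
  · simp only [eLpNorm_top_eq_essSup]
    apply le_antisymm
    · refine essSup_le_of_ae_le _ ?_
      filter_upwards [Measure.quasiMeasurePreserving_fst.ae (ENNReal.ae_le_essSup (μ := μ) f),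
        Measure.quasiMeasurePreserving_snd.ae (ENNReal.ae_le_essSup (μ := ν) g)] with z h1 h2
      exact mul_le_mul' h1 h2
    · set c := essSup (fun z : α × β => f z.1 * g z.2) (μ.prod ν)
      have h := Measure.ae_ae_of_ae_prod
        (ENNReal.ae_le_essSup (μ := μ.prod ν) fun z : α × β => f z.1 * g z.2)
      rw [mul_comm, ← ENNReal.essSup_const_mul]
      refine essSup_le_of_ae_le _ ?_
      filter_upwards [h] with x hx
      rw [mul_comm, ← ENNReal.essSup_const_mul]
      exact essSup_le_of_ae_le _ hx
  have hp : 0 < p.toReal := ENNReal.toReal_pos h0 ht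
  rw [eLpNorm_ennreal_eq h0 ht, eLpNorm_ennreal_eq h0 ht, eLpNorm_ennreal_eq h0 ht]
  simp only [ENNReal.mul_rpow_of_nonneg _ _ hp.le]
  rw [lintegral_prod_mul (f := fun x => f x ^ p.toReal) (g := fun x => g x ^ p.toReal)
    (hf.pow_const _).aemeasurable (hg.pow_const _).aemeasurable,
    ENNReal.mul_rpow_of_nonneg _ _ (by positivity)]

/-- Only p = ∞ needs an argument: the essential supremum of a section is at most a exactly when the
section of {h > a} is null, and measures of sections depend measurably on the parameter. -/
theorem measurable_eLpNorm_left [SFinite μ] (p : ℝ≥0∞) {h : α × β → ℝ≥0∞} (hh : Measurable h) :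
    Measurable fun y => eLpNorm (fun x => h (x, y)) p μ := by
  rcases eq_or_ne p 0 with rfl | h0
  · simp
  rcases eq_or_ne p ∞ with rfl | ht
  · simp only [eLpNorm_top_eq_essSup]
    refine measurable_of_Iic fun a => ?_
    have e : (fun y => essSup (fun x => h (x, y)) μ) ⁻¹' Set.Iic a
        = (fun y => μ ((fun x => (x, y)) ⁻¹' {z | a < h z})) ⁻¹' {0} := by
      ext y
      have : essSup (fun x => h (x, y)) μ ≤ a ↔ ∀ᵐ x ∂μ, h (x, y) ≤ a := by
        refine ⟨fun hle => ?_, essSup_le_of_ae_le _⟩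
        filter_upwards [ENNReal.ae_le_essSup (μ := μ) fun x => h (x, y)] with x hx
        exact hx.trans hle
      simp only [Set.mem_preimage, Set.mem_Iic, Set.mem_singleton_iff, this, ae_iff, not_le]
      rfl
    rw [e]
    exact measurable_measure_prodMk_right (measurableSet_lt measurable_const hh)
      (measurableSet_singleton 0)
  · simp only [eLpNorm_ennreal_eq h0 ht]
    exact ((hh.pow_const _).lintegral_prod_left').pow_const _

/-- **Minkowski's integral inequality.** -/
theorem eLpNorm_lintegral_le [SFinite μ] [SFinite ν] {p : ℝ≥0∞} (hp : 1 ≤ p)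
    {h : α × β → ℝ≥0∞} (hh : Measurable h) :
    eLpNorm (fun x => ∫⁻ y, h (x, y) ∂ν) p μ ≤ ∫⁻ y, eLpNorm (fun x => h (x, y)) p μ ∂ν := by
  set a : β → ℝ≥0∞ := fun y => eLpNorm (fun x => h (x, y)) p μ with ha
  have ham : Measurable a := measurable_eLpNorm_left p hh
  rcases eq_or_ne p ∞ with rfl | ht
  · rw [eLpNorm_top_eq_essSup]
    refine essSup_le_of_ae_le _ ?_
    have h1 : ∀ᵐ y ∂ν, ∀ᵐ x ∂μ, h (x, y) ≤ a y := Filter.Eventually.of_forall fun y => by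
      simp only [ha, eLpNorm_top_eq_essSup]
      exact ENNReal.ae_le_essSup _
    rw [Measure.ae_ae_comm (p := fun y x => h (x, y) ≤ a y)
      (measurableSet_le (by fun_prop) (by fun_prop))] at h1
    filter_upwards [h1] with x hx using lintegral_mono_ae hx
  have h0 : p ≠ 0 := (zero_lt_one.trans_le hp).ne'
  rcases hp.eq_or_lt with rfl | hp1
  · simp only [eLpNorm_one_eq_lintegral_enorm, enorm_eq_self, ha]
    exact (lintegral_lintegral_swap (f := fun x y => h (x, y)) hh.aemeasurable).le
  rcases eq_or_ne (∫⁻ y, a y ∂ν) ∞ with hA | hA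
  · rw [hA]; exact le_top
  have hr1 : 1 < p.toReal := by
    rw [← ENNReal.toReal_one]; exact (ENNReal.toReal_lt_toReal ENNReal.one_ne_top ht).2 hp1
  set r := p.toReal with hr
  have hr0 : 0 < r := zero_lt_one.trans hr1
  set s := Real.conjExponent r with hs
  have hrs : r.HolderConjugate s := Real.HolderConjugate.conjExponent hr1
  have har : ∀ y, a y ^ r = ∫⁻ x, h (x, y) ^ r ∂μ := fun y => by
    rw [ha]
    simp only [eLpNorm_ennreal_eq h0 ht]
    rw [← ENNReal.rpow_mul, one_div_mul_cancel hr0.ne', ENNReal.rpow_one]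
  have hfin : ∀ᵐ y ∂ν, a y < ∞ := ae_lt_top ham hA
  -- Hölder will be applied to the splitting h = (h a^{-1/s}) a^{1/s}. Where a y = 0 the negative
  -- power is infinite, but then h (·, y) vanishes almost everywhere, so the inequality still holds.
  have hzero : ∀ᵐ y ∂ν, ∀ᵐ x ∂μ, h (x, y) ≤ h (x, y) * a y ^ (-(1 / s)) * a y ^ (1 / s) := by
    filter_upwards [hfin] with y hy
    rcases eq_or_ne (a y) 0 with hz | hz
    · have h2 : ∫⁻ x, h (x, y) ^ r ∂μ = 0 := by rw [← har, hz, ENNReal.zero_rpow_of_pos hr0]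
      rw [lintegral_eq_zero_iff (by fun_prop)] at h2
      filter_upwards [h2] with x hx
      have : h (x, y) = 0 := by simpa [ENNReal.rpow_eq_zero_iff, hr0, hr0.not_gt] using hx
      simp [this]
    · refine Filter.Eventually.of_forall fun x => ?_
      rw [mul_assoc, ← ENNReal.rpow_add _ _ hz hy.ne]
      simp
  rw [Measure.ae_ae_comm
    (p := fun y x => h (x, y) ≤ h (x, y) * a y ^ (-(1 / s)) * a y ^ (1 / s))
    (measurableSet_le (by fun_prop) (by fun_prop))] at hzero
  have hx : ∀ᵐ x ∂μ, (∫⁻ y, h (x, y) ∂ν) ^ r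
      ≤ (∫⁻ y, h (x, y) ^ r * a y ^ (-(r / s)) ∂ν) * (∫⁻ y, a y ∂ν) ^ (r / s) := by
    filter_upwards [hzero] with x hx
    have h1 := (lintegral_mono_ae hx).trans (ENNReal.lintegral_mul_le_Lp_mul_Lq ν hrs
      (f := fun y => h (x, y) * a y ^ (-(1 / s))) (g := fun y => a y ^ (1 / s))
      (by fun_prop) (by fun_prop))
    have h2 := ENNReal.rpow_le_rpow h1 hr0.le
    refine h2.trans (le_of_eq ?_)
    rw [ENNReal.mul_rpow_of_nonneg _ _ hr0.le, ← ENNReal.rpow_mul, ← ENNReal.rpow_mul,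
      one_div_mul_cancel hr0.ne', ENNReal.rpow_one]
    congr 1
    · congr 1; funext y
      rw [ENNReal.mul_rpow_of_nonneg _ _ hr0.le, ← ENNReal.rpow_mul]
      congr 2; ring
    · congr 1
      · congr 1; funext y
        rw [← ENNReal.rpow_mul, one_div_mul_cancel hrs.symm.pos.ne', ENNReal.rpow_one]
      · ring
  have hmain : ∫⁻ x, (∫⁻ y, h (x, y) ∂ν) ^ r ∂μ ≤ (∫⁻ y, a y ∂ν) ^ r := by
    refine (lintegral_mono_ae hx).trans ?_
    have hm : Measurable fun z : α × β => h z ^ r * a z.2 ^ (-(r / s)) := by fun_prop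
    rw [lintegral_mul_const _ hm.lintegral_prod_right',
      lintegral_lintegral_swap
        (f := fun x y => h (x, y) ^ r * a y ^ (-(r / s))) hm.aemeasurable]
    -- Integrating in x first gives a^r · a^{-r/s}, which is a since r - r/s = 1.
    have h3 : ∫⁻ y, ∫⁻ x, h (x, y) ^ r * a y ^ (-(r / s)) ∂μ ∂ν ≤ ∫⁻ y, a y ∂ν := by
      refine lintegral_mono_ae ?_
      filter_upwards [hfin] with y hy
      rw [lintegral_mul_const _ (by fun_prop), ← har]
      rcases eq_or_ne (a y) 0 with hz | hz
      · simp [hz, hr0]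
      rw [← ENNReal.rpow_add _ _ hz hy.ne]
      have : r + -(r / s) = 1 := by
        have := hrs.symm.pos.ne'
        have h5 := hrs.sub_one_mul_conj
        field_simp; linarith
      rw [this, ENNReal.rpow_one]
    refine (mul_le_mul_left h3 _).trans (le_of_eq ?_)
    -- One factor ∫ a comes from `h3` and r/s of them from Hölder, in total the r-th power.
    have h6 : 1 + r / s = r := by
      have := hrs.symm.pos.ne'
      have h5 := hrs.sub_one_mul_conj
      field_simp; linarith
    conv_rhs => rw [← h6]
    rw [ENNReal.rpow_add_of_nonneg _ _ zero_le_one (div_pos hr0 hrs.symm.pos).le, ENNReal.rpow_one]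
  rw [eLpNorm_ennreal_eq h0 ht, ← hr]
  calc _ ≤ ((∫⁻ y, a y ∂ν) ^ r) ^ (1 / r) := ENNReal.rpow_le_rpow hmain (by positivity)
    _ = _ := by rw [← ENNReal.rpow_mul, mul_one_div_cancel hr0.ne', ENNReal.rpow_one]

end lebesgue

/-! ### Sections of Schwartz functions on a product and differentiation under the integral -/

section sections

/-- Differentiation commutes with G ↦ G(· + v) - G, so order n + 1 for G is order n for its
derivative. This is why the codomain varies in the induction; the base case is the mean value
estimate `lip`. -/
theorem iteratedFDeriv_translate_sub_bound (n : ℕ) : ∀ {E F : Type} [NormedAddCommGroup E]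
    [NormedSpace ℝ E] [NormedAddCommGroup F] [NormedSpace ℝ F] (G : 𝓢(E, F)) (k : ℕ),
    ∃ C : ℝ, 0 ≤ C ∧ ∀ z v : E, ‖v‖ ≤ 1 →
      ‖z‖ ^ k * ‖iteratedFDeriv ℝ n (fun z => G (z + v) - G z) z‖ ≤ C * ‖v‖ := by
  induction n with
  | zero =>
    intro E F _ _ _ _ G k
    obtain ⟨C, hC, h⟩ := lip G k
    refine ⟨C, hC, fun z v hv => ?_⟩
    rw [norm_iteratedFDeriv_zero]
    exact h z v _ hv (right_mem_segment _ _ _)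
  | succ n ih =>
    intro E F _ _ _ _ G k
    obtain ⟨C, hC, h⟩ := ih (SchwartzMap.fderivCLM ℝ E F G) k
    refine ⟨C, hC, fun z v hv => ?_⟩
    have e : fderiv ℝ (fun z => G (z + v) - G z) = fun z =>
        SchwartzMap.fderivCLM ℝ E F G (z + v) - SchwartzMap.fderivCLM ℝ E F G z := by
      funext z
      have h1 : HasFDerivAt (fun z => G (z + v)) (fderiv ℝ G (z + v)) z :=
        (hasFDerivAt_comp_add_right v).2 (G.hasFDerivAt (z + v))
      simpa using (h1.fun_sub (G.hasFDerivAt z)).fderiv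
    rw [← norm_iteratedFDeriv_fderiv, e]
    exact h z v hv

variable {X E F : Type} [NormedAddCommGroup X] [NormedSpace ℝ X]
  [NormedAddCommGroup E] [NormedSpace ℝ E] [NormedAddCommGroup F] [NormedSpace ℝ F]

/-- The section `u ↦ G (x, u)` of a Schwartz function on a product space. -/
noncomputable def sect (x : X) (G : 𝓢(X × E, F)) : 𝓢(E, F) :=
  SchwartzMap.compCLM ℝ (g := fun u : E => (x, u))
    (by
      have h : (fun u : E => (x, u)) = fun u => ((x, 0) : X × E) + ContinuousLinearMap.inr ℝ X E u := by
        funext u; simp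
      rw [h]
      exact (Function.HasTemperateGrowth.const _).add
        (ContinuousLinearMap.inr ℝ X E).hasTemperateGrowth)
    ⟨1, 1, fun u => by
      have : ‖u‖ ≤ ‖((x, u) : X × E)‖ := le_max_right _ _
      rw [pow_one]; linarith⟩ G

@[simp] theorem sect_apply (x : X) (G : 𝓢(X × E, F)) (u : E) : sect x G u = G (x, u) := rfl

theorem norm_iteratedFDeriv_sect_le (f : X × E → F) (n : ℕ) (hf : ContDiff ℝ n f) (x : X) (u : E) :
    ‖iteratedFDeriv ℝ n (fun u => f (x, u)) u‖ ≤ ‖iteratedFDeriv ℝ n f (x, u)‖ := by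
  have h : (fun u : E => f (x, u))
      = (fun z => f (z + ((x, 0) : X × E))) ∘ ContinuousLinearMap.inr ℝ X E := by
    funext u; simp
  have hc : ContDiff ℝ n (fun z => f (z + ((x, 0) : X × E))) :=
    hf.comp (contDiff_id.add contDiff_const)
  rw [h, ContinuousLinearMap.iteratedFDeriv_comp_right _ hc _ le_rfl,
    iteratedFDeriv_comp_add_right]
  have e : (ContinuousLinearMap.inr ℝ X E) u + ((x, 0) : X × E) = (x, u) := by simp
  rw [e]
  refine (ContinuousMultilinearMap.norm_compContinuousLinearMap_le _ _).trans ?_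
  refine mul_le_of_le_one_right (norm_nonneg _) ?_
  refine Finset.prod_le_one (fun _ _ => norm_nonneg _) fun _ _ => ?_
  refine ContinuousLinearMap.opNorm_le_bound _ zero_le_one fun x => ?_
  simp

/-- The difference of two sections is a section of the increment of G along (y - x, 0), so every
seminorm of it is O(‖y - x‖). -/
theorem continuous_sect (G : 𝓢(X × E, ℂ)) : Continuous fun x => sect x G := by
  rw [continuous_iff_continuousAt]
  intro x
  rw [ContinuousAt, (schwartz_withSeminorms ℝ E ℂ).tendsto_nhds]
  rintro ⟨k, n⟩ ε hε
  obtain ⟨C, hC, h⟩ := iteratedFDeriv_translate_sub_bound n G k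
  have key : ∀ y : X, ‖y - x‖ ≤ 1 →
      SchwartzMap.seminorm ℝ k n (sect y G - sect x G) ≤ C * ‖y - x‖ := by
    intro y hy
    refine SchwartzMap.seminorm_le_bound ℝ k n _ (by positivity) fun u => ?_
    have hn : ‖((y - x, 0) : X × E)‖ = ‖y - x‖ := by simp [Prod.norm_def]
    have h1 := h (x, u) (y - x, 0) (by rwa [hn])
    rw [hn] at h1
    have e : ⇑(sect y G - sect x G)
        = fun u => (fun z => G (z + ((y - x, 0) : X × E)) - G z) (x, u) := by
      funext u; simp
    rw [e]
    refine le_trans ?_ h1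
    have hc : ContDiff ℝ n (fun z => G (z + ((y - x, 0) : X × E)) - G z) :=
      ((G.smooth n).comp (contDiff_id.add contDiff_const)).sub (G.smooth n)
    have hu : ‖u‖ ≤ ‖((x, u) : X × E)‖ := le_max_right _ _
    gcongr
    exact norm_iteratedFDeriv_sect_le _ n hc x u
  have hpos : 0 < min 1 (ε / (C + 1)) := by positivity
  filter_upwards [Metric.ball_mem_nhds x hpos] with y hy
  rw [Metric.mem_ball, dist_eq_norm] at hy
  refine (key y (hy.le.trans (min_le_left _ _))).trans_lt ?_
  have h2 : ‖y - x‖ * (C + 1) < ε := (lt_div_iff₀ (by positivity)).1 (hy.trans_le (min_le_right _ _))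
  nlinarith [norm_nonneg (y - x)]

/-- Weights in x and in u are both absorbed by the weight of the pair. Taking N to be an integrable
power later makes each seminorm of the sections integrable in x. -/
theorem one_add_pow_mul_seminorm_sect_le (G : 𝓢(X × E, F)) (N k n : ℕ) :
    ∃ C : ℝ, 0 ≤ C ∧ ∀ x, SchwartzMap.seminorm ℝ k n (sect x G) ≤ C * (1 + ‖x‖) ^ (-(N : ℝ)) := by
  refine ⟨2 ^ (N + k) * (Finset.Iic (N + k, n)).sup
    (fun m => SchwartzMap.seminorm ℝ m.1 m.2) G, by positivity, fun x => ?_⟩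
  refine SchwartzMap.seminorm_le_bound ℝ k n _ (by positivity) fun u => ?_
  have h := SchwartzMap.one_add_le_sup_seminorm_apply (𝕜 := ℝ) (m := (N + k, n)) (k := N + k)
    (n := n) le_rfl le_rfl G (x, u)
  rw [Real.rpow_neg (by positivity), Real.rpow_natCast, ← div_eq_mul_inv,
    le_div_iff₀' (by positivity)]
  refine le_trans ?_ h
  have hx : ‖x‖ ≤ ‖((x, u) : X × E)‖ := le_max_left _ _
  have hu : ‖u‖ ≤ 1 + ‖((x, u) : X × E)‖ := (le_max_right ‖x‖ ‖u‖).trans (by simp [Prod.norm_def])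
  have h1 := norm_iteratedFDeriv_sect_le G n (G.smooth n) x u
  calc (1 + ‖x‖) ^ N * (‖u‖ ^ k * ‖iteratedFDeriv ℝ n (sect x G) u‖)
      ≤ (1 + ‖((x, u) : X × E)‖) ^ N * ((1 + ‖((x, u) : X × E)‖) ^ k
        * ‖iteratedFDeriv ℝ n G (x, u)‖) := by gcongr; exact h1
    _ = _ := by rw [pow_add]; ring

/-- The partial derivative in the second variable. -/
noncomputable def fderivSnd (G : 𝓢(X × E, F)) : 𝓢(X × E, E →L[ℝ] F) :=
  SchwartzMap.postcompCLM ((ContinuousLinearMap.compL ℝ E (X × E) F).flip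
    (ContinuousLinearMap.inr ℝ X E)) (SchwartzMap.fderivCLM ℝ (X × E) F G)

theorem sect_fderivSnd (G : 𝓢(X × E, F)) (x : X) :
    sect x (fderivSnd G) = SchwartzMap.fderivCLM ℝ E F (sect x G) := by
  ext u : 1
  have h1 : HasFDerivAt (fun u : E => (x, u)) (ContinuousLinearMap.inr ℝ X E) u := by
    have : (fun u : E => (x, u)) = fun u => ContinuousLinearMap.inr ℝ X E u + ((x, 0) : X × E) := by
      funext u; simp
    rw [this]
    exact (ContinuousLinearMap.inr ℝ X E).hasFDerivAt.add_const _
  have h2 : HasFDerivAt (sect x G) ((fderiv ℝ G (x, u)).comp (ContinuousLinearMap.inr ℝ X E)) u :=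
    HasFDerivAt.comp u (G.hasFDerivAt (x, u)) h1
  simp only [SchwartzMap.fderivCLM_apply, h2.fderiv]
  rfl

variable [MeasurableSpace X] [BorelSpace X] [SecondCountableTopology X] {μ : Measure X}
  [μ.HasTemperateGrowth]

theorem integrable_sect_apply (G : 𝓢(X × E, F)) (u : E) : Integrable (fun x => G (x, u)) μ := by
  obtain ⟨C, hC, h⟩ := one_add_pow_mul_seminorm_sect_le G μ.integrablePower 0 0
  have hc : Continuous fun x : X => G (x, u) := G.continuous.comp (by fun_prop)
  refine ((Measure.integrable_pow_neg_integrablePower μ).const_mul C).mono'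
    hc.aestronglyMeasurable (Filter.Eventually.of_forall fun x => ?_)
  exact (SchwartzMap.norm_le_seminorm ℝ (sect x G) u).trans (h x)

/-- The decay of the sections of the partial derivative is uniform in u and provides the dominating
function. -/
theorem hasFDerivAt_integral_sect (G : 𝓢(X × E, F)) (u : E) :
    HasFDerivAt (fun u => ∫ x, G (x, u) ∂μ) (∫ x, fderivSnd G (x, u) ∂μ) u := by
  obtain ⟨C, hC, h⟩ := one_add_pow_mul_seminorm_sect_le (fderivSnd G) μ.integrablePower 0 0
  refine hasFDerivAt_integral_of_dominated_of_fderiv_le (s := Set.univ)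
    (F' := fun u x => fderivSnd G (x, u)) (bound := fun x => C * (1 + ‖x‖) ^ (-(μ.integrablePower : ℝ)))
    Filter.univ_mem
    (Filter.Eventually.of_forall fun p => (integrable_sect_apply G p).aestronglyMeasurable)
    (integrable_sect_apply G u) (integrable_sect_apply (fderivSnd G) u).aestronglyMeasurable
    (Filter.Eventually.of_forall fun x p _ => ?_)
    ((Measure.integrable_pow_neg_integrablePower μ).const_mul C)
    (Filter.Eventually.of_forall fun x p _ => ?_)
  · exact (SchwartzMap.norm_le_seminorm ℝ (sect x (fderivSnd G)) p).trans (h x)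
  · have h1 : fderivSnd G (x, p) = fderiv ℝ (sect x G) p := by
      rw [← sect_apply, sect_fderivSnd]; rfl
    rw [h1]
    exact (sect x G).hasFDerivAt p

end sections

/-! ### Moving a tempered distribution inside an integral of test functions -/

section integration

variable {X E : Type} [NormedAddCommGroup X] [NormedSpace ℝ X] [NormedAddCommGroup E]
  [NormedSpace ℝ E] [MeasurableSpace X] [BorelSpace X] [SecondCountableTopology X]
  {μ : Measure X} [μ.HasTemperateGrowth]

/-- Induction via `fderivSnd`: the derivative of θ is again the integral of sections of a Schwartz
function, and the currying isometries commute with the Bochner integral. That θ is Schwartz is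
assumed, since in the application θ is known explicitly. -/
theorem iteratedFDeriv_integral_sect (n : ℕ) : ∀ {F : Type} [NormedAddCommGroup F]
    [NormedSpace ℝ F] [CompleteSpace F]
    (G : 𝓢(X × E, F)) (θ : 𝓢(E, F)), (∀ u, θ u = ∫ x, G (x, u) ∂μ) → ∀ u,
    iteratedFDeriv ℝ n θ u = ∫ x, iteratedFDeriv ℝ n (sect x G) u ∂μ := by
  induction n with
  | zero =>
    intro F _ _ _ G θ h u
    have e : ∀ f : E → F, iteratedFDeriv ℝ 0 f u
        = (continuousMultilinearCurryFin0 ℝ E F).symm (f u) := fun f => by ext; simp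
    simp only [e, h]
    exact ((continuousMultilinearCurryFin0 ℝ E F).symm.toContinuousLinearEquiv.integral_comp_comm
      (fun x => G (x, u))).symm
  | succ n ih =>
    intro F _ _ _ G θ h u
    have h1 := ih (fderivSnd G) (SchwartzMap.fderivCLM ℝ E F θ) (fun u => by
      have : (θ : E → F) = fun u => ∫ x, G (x, u) ∂μ := funext h
      rw [SchwartzMap.fderivCLM_apply, this, (hasFDerivAt_integral_sect G u).fderiv]) u
    have e : ∀ f : 𝓢(E, F), iteratedFDeriv ℝ (n + 1) f u
        = (continuousMultilinearCurryRightEquiv' ℝ n E F).symm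
          (iteratedFDeriv ℝ n (SchwartzMap.fderivCLM ℝ E F f) u) := fun f => by
      rw [iteratedFDeriv_succ_eq_comp_right]
      have : ⇑(SchwartzMap.fderivCLM ℝ E F f) = fun y => fderiv ℝ f y := by funext y; simp
      rw [this]; rfl
    simp only [e, h1, sect_fderivSnd]
    let L : (E [×n]→L[ℝ] E →L[ℝ] F) →ₗᵢ[ℝ] (E [×(n + 1)]→L[ℝ] F) :=
      (continuousMultilinearCurryRightEquiv' ℝ n E F).symm.toLinearIsometry
    exact (LinearIsometry.integral_comp_comm (𝕜 := ℝ) (E := E [×n]→L[ℝ] E →L[ℝ] F)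
      (F := E [×(n + 1)]→L[ℝ] F) (μ := μ) L
      (fun x => iteratedFDeriv ℝ n (SchwartzMap.fderivCLM ℝ E F (sect x G)) u)).symm




/-- The bound forces f to vanish on the kernel of J, so f descends to a bounded functional on the
range of J. Hahn–Banach extends it. -/
theorem exists_factorization_of_norm_le {V T : Type*} [AddCommGroup V] [Module ℂ V]
    [NormedAddCommGroup T] [NormedSpace ℂ T] (f : V →ₗ[ℂ] ℂ) (J : V →ₗ[ℂ] T) (C : NNReal)
    (h : ∀ ψ, ‖f ψ‖ ≤ C * ‖J ψ‖) : ∃ Λ : T →L[ℂ] ℂ, ∀ ψ, f ψ = Λ (J ψ) := by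
  have hker : LinearMap.ker J ≤ LinearMap.ker f := by
    intro ψ hψ
    rw [LinearMap.mem_ker] at hψ ⊢
    have := h ψ
    rw [hψ, norm_zero, mul_zero] at this
    exact norm_le_zero_iff.1 this
  let g : Module.Dual ℂ (LinearMap.range J) :=
    ((LinearMap.ker J).liftQ f hker) ∘ₗ J.quotKerEquivRange.symm.toLinearMap
  have hg : ∀ ψ, g ⟨J ψ, ψ, rfl⟩ = f ψ := fun ψ => by
    have : J.quotKerEquivRange.symm ⟨J ψ, ψ, rfl⟩ = Submodule.Quotient.mk ψ := by
      rw [LinearEquiv.symm_apply_eq]; rfl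
    change (LinearMap.ker J).liftQ f hker (J.quotKerEquivRange.symm ⟨J ψ, ψ, rfl⟩) = _
    rw [this]; rfl
  obtain ⟨Λ, hΛ, -⟩ := Module.Dual.exists_continuous_extension_of_le_seminorm
    (LinearMap.range J) g (p := C • normSeminorm ℂ T) (continuous_norm.const_smul C)
    (by
      rintro ⟨_, ψ, rfl⟩
      have := h ψ
      rw [← hg ψ] at this
      exact this)
  exact ⟨Λ, fun ψ => by rw [← hg ψ]; exact (hΛ ⟨J ψ, ψ, rfl⟩).symm⟩

/-- A tempered distribution factors through a Banach space in which derivatives of bounded order,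
with polynomial weights, can be evaluated. -/
theorem exists_dual_factorization (f : 𝓢(E, ℂ) →L[ℂ] ℂ) :
    ∃ (T : Type) (_ : NormedAddCommGroup T) (_ : NormedSpace ℂ T) (_ : CompleteSpace T)
      (s : Finset (ℕ × ℕ)) (Λ : T →L[ℂ] ℂ) (J : 𝓢(E, ℂ) →L[ℂ] T)
      (ev : (i : s) → E → T →L[ℂ] (E [×i.1.2]→L[ℝ] ℂ)),
      (∀ ψ, f ψ = Λ (J ψ)) ∧ (∀ ψ i t, ev i t (J ψ) = ‖t‖ ^ i.1.1 • iteratedFDeriv ℝ i.1.2 ψ t) ∧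
      (∀ a b, (∀ i t, ev i t a = ev i t b) → a = b) ∧
      (∀ ψ, ‖J ψ‖ ≤ ∑ i ∈ s, SchwartzMap.seminorm ℝ i.1 i.2 ψ) := by
  obtain ⟨s, C, -, hC⟩ := Seminorm.bound_of_continuous (schwartz_withSeminorms ℂ E ℂ)
    (absSeminorm f) (absSeminorm_continuous f)
  -- The sup norm of this bounded continuous function is the (k, n) seminorm of ψ. The finitely many
  -- seminorms controlling f thus become the norm of a product of Banach spaces, on which point
  -- evaluations are continuous and separate points.
  let A : (i : ℕ × ℕ) → 𝓢(E, ℂ) → BoundedContinuousFunction E (E [×i.2]→L[ℝ] ℂ) := fun i ψ =>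
    BoundedContinuousFunction.ofNormedAddCommGroup
      (fun t => ‖t‖ ^ i.1 • iteratedFDeriv ℝ i.2 ψ t)
      ((continuous_norm.pow _).smul ((ψ.smooth i.2).continuous_iteratedFDeriv le_rfl))
      (SchwartzMap.seminorm ℝ i.1 i.2 ψ) (fun t => by
        rw [norm_smul, norm_pow, norm_norm]
        exact SchwartzMap.le_seminorm ℝ _ _ _ _)
  have hAn : ∀ i ψ, ‖A i ψ‖ ≤ SchwartzMap.seminorm ℝ i.1 i.2 ψ := fun i ψ =>
    BoundedContinuousFunction.norm_ofNormedAddCommGroup_le _ (apply_nonneg _ _) _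
  let B : (i : ℕ × ℕ) → 𝓢(E, ℂ) →L[ℂ] BoundedContinuousFunction E (E [×i.2]→L[ℝ] ℂ) := fun i =>
    SchwartzMap.mkCLMtoNormedSpace (σ := RingHom.id ℂ) (A i)
      (fun φ ψ => by
        ext1 t
        change ‖t‖ ^ i.1 • iteratedFDeriv ℝ i.2 (φ + ψ : E → ℂ) t
          = ‖t‖ ^ i.1 • iteratedFDeriv ℝ i.2 φ t + ‖t‖ ^ i.1 • iteratedFDeriv ℝ i.2 ψ t
        rw [iteratedFDeriv_add (φ.smooth i.2) (ψ.smooth i.2), Pi.add_apply, smul_add])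
      (fun a ψ => by
        ext1 t
        change ‖t‖ ^ i.1 • iteratedFDeriv ℝ i.2 (a • ψ : E → ℂ) t
          = a • ‖t‖ ^ i.1 • iteratedFDeriv ℝ i.2 ψ t
        rw [iteratedFDeriv_const_smul_apply (ψ.smooth i.2).contDiffAt, smul_comm])
      ⟨{i}, 1, zero_le_one, fun ψ => by
        rw [Finset.sup_singleton, one_mul]; exact hAn i ψ⟩
  let J : 𝓢(E, ℂ) →L[ℂ] ((i : s) → BoundedContinuousFunction E (E [×i.1.2]→L[ℝ] ℂ)) :=
    ContinuousLinearMap.pi fun i => B i.1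
  have hfJ : ∀ ψ, ‖f ψ‖ ≤ C * ‖J ψ‖ := by
    intro ψ
    refine (hC ψ).trans ?_
    refine mul_le_mul_of_nonneg_left ?_ C.2
    refine Seminorm.finset_sup_apply_le (norm_nonneg _) fun i hi => ?_
    refine SchwartzMap.seminorm_le_bound ℂ _ _ _ (norm_nonneg _) fun t => ?_
    have h1 : ‖J ψ ⟨i, hi⟩ t‖ ≤ ‖J ψ‖ :=
      (BoundedContinuousFunction.norm_coe_le_norm _ t).trans (norm_le_pi_norm (J ψ) ⟨i, hi⟩)
    refine le_trans (le_of_eq ?_) h1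
    change _ = ‖‖t‖ ^ i.1 • iteratedFDeriv ℝ i.2 ψ t‖
    rw [norm_smul, norm_pow, norm_norm]
  obtain ⟨Λ, hΛ⟩ := exists_factorization_of_norm_le
    (T := (i : s) → BoundedContinuousFunction E (E [×i.1.2]→L[ℝ] ℂ)) f.toLinearMap J.toLinearMap C hfJ
  let ev : (i : s) → E → ((i : s) → BoundedContinuousFunction E (E [×i.1.2]→L[ℝ] ℂ)) →L[ℂ]
      (E [×i.1.2]→L[ℝ] ℂ) := fun i t =>
    (BoundedContinuousFunction.evalCLM ℂ t).comp (ContinuousLinearMap.proj (R := ℂ)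
      (φ := fun i : s => BoundedContinuousFunction E (E [×i.1.2]→L[ℝ] ℂ)) i)
  refine ⟨(i : s) → BoundedContinuousFunction E (E [×i.1.2]→L[ℝ] ℂ), inferInstance, inferInstance,
    inferInstance, s, Λ, J, ev, hΛ, fun ψ i t => rfl, fun a b h => ?_, fun ψ => ?_⟩
  · funext i
    ext1 t
    exact h i t
  · refine (pi_norm_le_iff_of_nonneg (Finset.sum_nonneg fun i _ => apply_nonneg _ _)).2 fun i => ?_
    exact (hAn i.1 ψ).trans (Finset.single_le_sum
      (f := fun i : ℕ × ℕ => SchwartzMap.seminorm ℝ i.1 i.2 ψ) (fun i _ => apply_nonneg _ _) i.2)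

/-- A tempered distribution commutes with the integral of a Schwartz family. -/
theorem apply_eq_integral_sect (f : 𝓢(E, ℂ) →L[ℂ] ℂ) (G : 𝓢(X × E, ℂ)) (θ : 𝓢(E, ℂ))
    (hθ : ∀ u, θ u = ∫ x, G (x, u) ∂μ) : f θ = ∫ x, f (sect x G) ∂μ := by
  obtain ⟨T, _, _, _, s, Λ, J, ev, hΛ, hJ, hsep, hJn⟩ := exists_dual_factorization f
  choose C hC hCb using fun i : ℕ × ℕ =>
    one_add_pow_mul_seminorm_sect_le G μ.integrablePower i.1 i.2
  have hcont : Continuous fun x => J (sect x G) := J.continuous.comp (continuous_sect G)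
  have hint : Integrable (fun x => J (sect x G)) μ := by
    refine ((Measure.integrable_pow_neg_integrablePower μ).const_mul (∑ i ∈ s, C i)).mono'
      hcont.aestronglyMeasurable (Filter.Eventually.of_forall fun x => ?_)
    rw [Finset.sum_mul]
    exact (hJn _).trans (Finset.sum_le_sum fun i _ => hCb i x)
  -- The equality in T is tested against evaluations, where it becomes differentiation under the
  -- integral sign.
  have key : J θ = ∫ x, J (sect x G) ∂μ := by
    refine hsep _ _ fun i t => ?_
    rw [← (ev i t).integral_comp_comm hint]
    simp only [hJ]
    rw [integral_smul, iteratedFDeriv_integral_sect i.1.2 G θ hθ t]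
  rw [hΛ, key, ← Λ.integral_comp_comm hint]
  simp only [hΛ]

end integration

/-! ### Fourier inversion and the short-time Fourier transform of Schwartz functions -/

section inversion

variable {E : Type} [NormedAddCommGroup E] [InnerProductSpace ℝ E] [FiniteDimensional ℝ E]
  [MeasurableSpace E] [BorelSpace E]

theorem conj_fourierConst : starRingEnd ℂ (fourierConst E) = fourierConst E :=
  Complex.conj_ofReal _

theorem fourierConst_sq_mul :
    fourierConst E * fourierConst E * (((2 * π) ^ Module.finrank ℝ E : ℝ) : ℂ) = 1 := by
  rw [fourierConst, ← Complex.ofReal_mul, ← Complex.ofReal_mul, ← Complex.ofReal_one]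
  congr 1
  rw [← Real.rpow_natCast, ← Real.rpow_add (by positivity), ← Real.rpow_add (by positivity)]
  ring_nf
  exact Real.rpow_zero _

theorem integral_mul_cexp_eq_fourier (g : 𝓢(E, ℂ)) (ζ : E) :
    ∫ y, g y * Complex.exp (-(Complex.I * (inner ℝ y ζ : ℝ)))
      = FourierTransform.fourier g ((2 * π)⁻¹ • ζ) := by
  rw [SchwartzMap.fourier_coe, Real.fourier_eq']
  congr 1
  funext y
  rw [smul_eq_mul, mul_comm]
  congr 2
  rw [inner_smul_right]
  push_cast
  field_simp

/-- The dilation ζ = 2πw reduces this to inversion for the kernel e^{-2πi⟨y, w⟩}. Its Jacobian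
(2π)^n cancels the two normalizing constants. -/
theorem fourier_inversion (g : 𝓢(E, ℂ)) (t : E) :
    fourierConst E * ∫ ζ, (fourierConst E
      * ∫ y, g y * Complex.exp (-(Complex.I * (inner ℝ y ζ : ℝ))))
      * Complex.exp (Complex.I * (inner ℝ t ζ : ℝ)) = g t := by
  have h1 : ∀ ζ : E, (fourierConst E
      * ∫ y, g y * Complex.exp (-(Complex.I * (inner ℝ y ζ : ℝ))))
      * Complex.exp (Complex.I * (inner ℝ t ζ : ℝ))
      = fourierConst E * (fun w : E => FourierTransform.fourier g w
        * Complex.exp (Complex.I * (2 * π * inner ℝ t w : ℝ))) ((2 * π)⁻¹ • ζ) := by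
    intro ζ
    rw [integral_mul_cexp_eq_fourier]
    simp only [inner_smul_right]
    rw [mul_assoc]
    congr 4
    push_cast
    field_simp
  simp only [h1]
  rw [integral_const_mul, Measure.integral_comp_inv_smul volume (fun w : E =>
    FourierTransform.fourier g w * Complex.exp (Complex.I * (2 * π * inner ℝ t w : ℝ))),
    abs_of_pos (by positivity)]
  have h2 : ∫ w : E, FourierTransform.fourier g w
      * Complex.exp (Complex.I * (2 * π * inner ℝ t w : ℝ)) = g t := by
    have h3 : FourierTransformInv.fourierInv (FourierTransform.fourier g) t = g t := by
      rw [FourierTransform.fourierInv_fourier_eq]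
    rw [← h3, SchwartzMap.fourierInv_coe, Real.fourierInv_eq']
    congr 1
    funext w
    rw [smul_eq_mul, mul_comm, real_inner_comm]
    congr 2
    push_cast
    ring
  rw [h2, Complex.real_smul, ← mul_assoc, ← mul_assoc, fourierConst_sq_mul, one_mul]

/-- The short-time Fourier transform of two Schwartz functions on `E × E`. -/
noncomputable def stftProd (φ f : 𝓢(E, ℂ)) : 𝓢(E × E, ℂ) :=
  partialFourier (SchwartzMap.compCLMOfContinuousLinearEquiv ℂ (shear E) (tensor f (conjS φ)))

theorem stftProd_apply (φ f : 𝓢(E, ℂ)) (x ξ : E) :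
    stftProd φ f (x, ξ) = fourierConst E *
      ∫ y, f y * starRingEnd ℂ (φ (y - x)) * Complex.exp (-(Complex.I * (inner ℝ y ξ : ℝ))) :=
  rfl

theorem schwartzSTFT_toLp (φ f : 𝓢(E, ℂ)) (p : E × E) :
    schwartzSTFT φ f (WithLp.toLp 2 p) = stftProd φ f p := rfl

/-- For fixed x, V_φ f(x, ·) is the Fourier transform of y ↦ f(y) conj φ(y - x), so this is
inversion of one slice. -/
theorem integral_stftProd (φ f : 𝓢(E, ℂ)) (x t : E) :
    fourierConst E * ∫ ξ, stftProd φ f (x, ξ) * Complex.exp (Complex.I * (inner ℝ t ξ : ℝ))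
      = f t * starRingEnd ℂ (φ (t - x)) :=
  fourier_inversion (slice x (SchwartzMap.compCLMOfContinuousLinearEquiv ℂ (shear E)
    (tensor f (conjS φ)))) t

/-- Covariance under time-frequency shifts: translating the integration variable by z changes the
integral only by a phase. The kernel of the reproducing formula, taken at an atom, thus has a
modulus depending only on differences, which makes it a convolution kernel. -/
theorem norm_stftProd_stftAtom (φ χ : 𝓢(E, ℂ)) (x ξ z ζ : E) :
    ‖stftProd (conjS φ) (stftAtom χ x ξ) (z, -ζ)‖ = ‖stftProd χ φ (x - z, ξ - ζ)‖ := by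
  rw [stftProd_apply, stftProd_apply]
  have h : ∫ y, stftAtom χ x ξ y * starRingEnd ℂ (conjS φ (y - z))
        * Complex.exp (-(Complex.I * (inner ℝ y (-ζ) : ℝ)))
      = Complex.exp (-(Complex.I * (inner ℝ z (ξ - ζ) : ℝ))) *
        ∫ y, φ y * starRingEnd ℂ (χ (y - (x - z)))
          * Complex.exp (-(Complex.I * (inner ℝ y (ξ - ζ) : ℝ))) := by
    rw [← integral_sub_right_eq_self (fun y => φ y * starRingEnd ℂ (χ (y - (x - z)))
      * Complex.exp (-(Complex.I * (inner ℝ y (ξ - ζ) : ℝ)))) z, ← integral_const_mul]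
    congr 1
    funext y
    rw [stftAtom_apply, conjS_apply, Complex.conj_conj, show y - z - (x - z) = y - x by abel,
      inner_sub_left]
    have e : Complex.exp (-(Complex.I * (inner ℝ z (ξ - ζ) : ℝ)))
        * Complex.exp (-(Complex.I * ((inner ℝ y (ξ - ζ) - inner ℝ z (ξ - ζ) : ℝ) : ℂ)))
        = Complex.exp (-(Complex.I * (inner ℝ y ξ : ℝ)))
          * Complex.exp (-(Complex.I * (inner ℝ y (-ζ) : ℝ))) := by
      rw [← Complex.exp_add, ← Complex.exp_add]
      congr 1
      simp only [inner_sub_right, inner_neg_right]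
      push_cast; ring
    linear_combination (-(φ (y - z) * starRingEnd ℂ (χ (y - x)))) * e
  rw [h, norm_mul, norm_mul, norm_mul, norm_cexp_neg_I, one_mul]

end inversion

/-! ### Families of atoms, continuity of V_φ f, and the reproducing formula -/

section atoms

/-- The tensor product `(y, u) ↦ f y * g u` of two Schwartz functions on different spaces. -/
noncomputable def tensorProd {D₁ D₂ : Type} [NormedAddCommGroup D₁] [NormedSpace ℝ D₁]
    [NormedAddCommGroup D₂] [NormedSpace ℝ D₂] (f : 𝓢(D₁, ℂ)) (g : 𝓢(D₂, ℂ)) :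
    𝓢(D₁ × D₂, ℂ) where
  toFun p := f p.1 * g p.2
  smooth' := ((f.smooth ⊤).comp contDiff_fst).mul ((g.smooth ⊤).comp contDiff_snd)
  decay' := by
    intro k n
    let sf := fun a b => SchwartzMap.seminorm ℝ a b f
    let sg := fun a b => SchwartzMap.seminorm ℝ a b g
    refine ⟨∑ i ∈ Finset.range (n + 1), (n.choose i : ℝ) *
      (sf k i * sg 0 (n - i) + sf 0 i * sg k (n - i)), fun z => ?_⟩
    have h1 : ContDiff ℝ n fun p : D₁ × D₂ => f p.1 := (f.smooth n).comp contDiff_fst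
    have h2 : ContDiff ℝ n fun p : D₁ × D₂ => g p.2 := (g.smooth n).comp contDiff_snd
    have h := norm_iteratedFDeriv_mul_le h1 h2 z (n := n) le_rfl
    refine (mul_le_mul_of_nonneg_left h (by positivity)).trans ?_
    rw [Finset.mul_sum]
    refine Finset.sum_le_sum fun i _ => ?_
    have hf := norm_iteratedFDeriv_comp_clm_le (ContinuousLinearMap.fst ℝ D₁ D₂)
      (ContinuousLinearMap.norm_fst_le ℝ D₁ D₂) f i z
    have hg := norm_iteratedFDeriv_comp_clm_le (ContinuousLinearMap.snd ℝ D₁ D₂)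
      (ContinuousLinearMap.norm_snd_le ℝ D₁ D₂) g (n - i) z
    simp only [ContinuousLinearMap.coe_fst', ContinuousLinearMap.coe_snd'] at hf hg
    have hz : ‖z‖ ^ k ≤ ‖z.1‖ ^ k + ‖z.2‖ ^ k := by
      rw [Prod.norm_def]
      rcases max_choice ‖z.1‖ ‖z.2‖ with h | h <;> rw [h]
      · linarith [pow_nonneg (norm_nonneg z.2) k]
      · linarith [pow_nonneg (norm_nonneg z.1) k]
    have b1 := SchwartzMap.le_seminorm ℝ k i f z.1
    have b2 := SchwartzMap.norm_iteratedFDeriv_le_seminorm ℝ f i z.1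
    have b3 := SchwartzMap.le_seminorm ℝ k (n - i) g z.2
    have b4 := SchwartzMap.norm_iteratedFDeriv_le_seminorm ℝ g (n - i) z.2
    calc ‖z‖ ^ k * ((n.choose i : ℝ) * ‖iteratedFDeriv ℝ i (fun p : D₁ × D₂ => f p.1) z‖
          * ‖iteratedFDeriv ℝ (n - i) (fun p : D₁ × D₂ => g p.2) z‖)
        ≤ (‖z.1‖ ^ k + ‖z.2‖ ^ k) * ((n.choose i : ℝ) * ‖iteratedFDeriv ℝ i f z.1‖
          * ‖iteratedFDeriv ℝ (n - i) g z.2‖) := by gcongr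
      _ = (n.choose i : ℝ) * ((‖z.1‖ ^ k * ‖iteratedFDeriv ℝ i f z.1‖)
            * ‖iteratedFDeriv ℝ (n - i) g z.2‖
          + ‖iteratedFDeriv ℝ i f z.1‖
            * (‖z.2‖ ^ k * ‖iteratedFDeriv ℝ (n - i) g z.2‖)) := by ring
      _ ≤ _ := by
        have : 0 ≤ sf k i := apply_nonneg _ _
        have : 0 ≤ sf 0 i := apply_nonneg _ _
        gcongr

variable {E : Type} [NormedAddCommGroup E] [InnerProductSpace ℝ E] [FiniteDimensional ℝ E]
  [MeasurableSpace E] [BorelSpace E]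

theorem temperate_chirp : Function.HasTemperateGrowth fun q : (E × E) × E =>
    Complex.exp (-(Complex.I * (inner ℝ q.2 q.1.2 : ℝ))) := by
  have h1 : Function.HasTemperateGrowth fun q : (E × E) × E => (inner ℝ q.2 q.1.2 : ℝ) :=
    (innerSL ℝ (E := E)).bilinear_hasTemperateGrowth
      (ContinuousLinearMap.snd ℝ (E × E) E).hasTemperateGrowth
      ((ContinuousLinearMap.snd ℝ E E).comp (ContinuousLinearMap.fst ℝ (E × E) E)).hasTemperateGrowth
  have h2 := (temperate_modulation (1 : ℝ)).comp h1
  have e : (fun q : (E × E) × E => Complex.exp (-(Complex.I * (inner ℝ q.2 q.1.2 : ℝ))))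
      = (fun y : ℝ => Complex.exp (-(Complex.I * (inner ℝ y 1 : ℝ)))) ∘
        fun q : (E × E) × E => (inner ℝ q.2 q.1.2 : ℝ) := by
    funext q; simp
  rw [e]; exact h2

/-- The linear change of variables `((z, ζ), t) ↦ ((z, ζ), t - z)`. -/
noncomputable def shiftEquiv (E : Type) [NormedAddCommGroup E] [NormedSpace ℝ E] :
    ((E × E) × E) ≃L[ℝ] ((E × E) × E) where
  toFun q := (q.1, q.2 - q.1.1)
  invFun q := (q.1, q.2 + q.1.1)
  map_add' p q := by ext <;> simp; abel
  map_smul' a p := by ext <;> simp [smul_sub]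
  left_inv p := by ext <;> simp
  right_inv p := by ext <;> simp
  continuous_toFun := by fun_prop
  continuous_invFun := by fun_prop

/-- The family `((z, ζ), t) ↦ B (z, ζ) conj (φ (t - z)) e^{-i⟨t, ζ⟩}` of weighted atoms. -/
noncomputable def atomFamily (φ : 𝓢(E, ℂ)) (B : 𝓢(E × E, ℂ)) : 𝓢((E × E) × E, ℂ) :=
  SchwartzMap.smulLeftCLM ℂ (fun q : (E × E) × E =>
      Complex.exp (-(Complex.I * (inner ℝ q.2 q.1.2 : ℝ))))
    (SchwartzMap.compCLMOfContinuousLinearEquiv ℂ (shiftEquiv E) (tensorProd B (conjS φ)))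

theorem sect_atomFamily (φ : 𝓢(E, ℂ)) (B : 𝓢(E × E, ℂ)) (p : E × E) :
    sect p (atomFamily φ B) = B p • stftAtom φ p.1 p.2 := by
  ext t
  rw [sect_apply, atomFamily, SchwartzMap.smulLeftCLM_apply_apply temperate_chirp, smul_apply,
    stftAtom_apply]
  change _ * (B p * starRingEnd ℂ (φ (t - p.1))) = B p * _
  ring

/-- The atoms do not decay in the phase-space parameter, so they are first multiplied by a bump
equal to 1 near the given point. The localized atoms are sections of one Schwartz function, and
sections vary continuously. -/
theorem continuous_stft (φ : 𝓢(E, ℂ)) (f : 𝓢'(E, ℂ)) : Continuous (stft φ f) := by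
  rw [continuous_iff_continuousAt]
  intro p₀
  let b : ContDiffBump p₀ := default
  have hs : HasCompactSupport fun p => (b p : ℂ) :=
    b.hasCompactSupport.comp_left (g := fun r : ℝ => (r : ℂ)) Complex.ofReal_zero
  have hc : ContDiff ℝ ((⊤ : ℕ∞) : WithTop ℕ∞) fun p => (b p : ℂ) :=
    Complex.ofRealCLM.contDiff.comp b.contDiff
  let B : 𝓢(E × E, ℂ) := hs.toSchwartzMap hc
  have hB : ∀ᶠ p in nhds p₀, B p = 1 := by
    filter_upwards [b.eventuallyEq_one] with p hp
    change (b p : ℂ) = 1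
    rw [hp]; simp
  have h1 : Continuous fun p => f (sect p (atomFamily φ B)) :=
    f.continuous.comp (continuous_sect _)
  have h2 : (fun p => fourierConst E * f (sect p (atomFamily φ B))) =ᶠ[nhds p₀] stft φ f := by
    filter_upwards [hB] with p hp
    rw [sect_atomFamily, hp, one_smul, stft]
  exact ((continuous_const.mul h1).continuousAt).congr h2

/-- The reproducing formula: a tempered distribution is recovered from its short-time Fourier
transform. -/
theorem reproducing_formula (φ ψ : 𝓢(E, ℂ)) (f : 𝓢'(E, ℂ)) :
    (∫ t, ((‖φ t‖ ^ 2 : ℝ) : ℂ)) * f ψ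
      = ∫ p : E × E, stftProd (conjS φ) ψ (p.1, -p.2) * stft φ f p := by
  let R : (E × E) ≃L[ℝ] (E × E) :=
    (ContinuousLinearEquiv.refl ℝ E).prodCongr (ContinuousLinearEquiv.neg ℝ)
  let B : 𝓢(E × E, ℂ) := fourierConst E •
    SchwartzMap.compCLMOfContinuousLinearEquiv ℂ R (stftProd (conjS φ) ψ)
  have hB : ∀ z ζ, B (z, ζ) = fourierConst E * stftProd (conjS φ) ψ (z, -ζ) := fun _ _ => rfl
  have hG : ∀ p t, atomFamily φ B (p, t) = B p * stftAtom φ p.1 p.2 t := fun p t => by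
    rw [← sect_apply, sect_atomFamily]; rfl
  -- Integrating in ζ inverts the Fourier transform and produces ψ(t) |φ(t - z)|²; integrating in z
  -- then gives the squared L² norm of φ.
  have hθ : ∀ t, ((∫ t, ((‖φ t‖ ^ 2 : ℝ) : ℂ)) • ψ) t = ∫ p, atomFamily φ B (p, t) := by
    intro t
    rw [Measure.volume_eq_prod, integral_prod _ (integrable_sect_apply (atomFamily φ B) t)]
    have h1 : ∀ z, ∫ ζ, atomFamily φ B ((z, ζ), t)
        = ((‖φ (t - z)‖ ^ 2 : ℝ) : ℂ) * ψ t := by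
      intro z
      have h2 : ∀ ζ, atomFamily φ B ((z, ζ), t) = (fun ξ => starRingEnd ℂ (φ (t - z)) *
          (fourierConst E * (stftProd (conjS φ) ψ (z, ξ)
            * Complex.exp (Complex.I * (inner ℝ t ξ : ℝ))))) (-ζ) := by
        intro ζ
        rw [hG, hB, stftAtom_apply]
        simp only [inner_neg_right]
        push_cast
        rw [mul_neg]
        ring
      simp only [h2]
      rw [integral_neg_eq_self (fun ξ => starRingEnd ℂ (φ (t - z)) *
          (fourierConst E * (stftProd (conjS φ) ψ (z, ξ)
            * Complex.exp (Complex.I * (inner ℝ t ξ : ℝ)))))]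
      rw [integral_const_mul, integral_const_mul, integral_stftProd, conjS_apply, Complex.conj_conj,
        Complex.ofReal_pow, ← Complex.conj_mul']
      ring
    simp only [h1]
    rw [integral_mul_const, integral_sub_left_eq_self (fun z => ((‖φ z‖ ^ 2 : ℝ) : ℂ)) volume t]
    rfl
  have hv : (volume : Measure (E × E)).IsAddHaarMeasure :=
    inferInstanceAs ((volume : Measure E).prod volume).IsAddHaarMeasure
  have h := apply_eq_integral_sect (μ := volume) (f : 𝓢(E, ℂ) →L[ℂ] ℂ) (atomFamily φ B) _ hθ
  refine (map_smul f _ ψ).symm.trans (h.trans ?_)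
  congr 1
  funext p
  rw [sect_atomFamily]
  refine (map_smul f (B p) _).trans ?_
  rw [show B p = fourierConst E * stftProd (conjS φ) ψ (p.1, -p.2) from hB p.1 p.2, smul_eq_mul]
  exact mul_assoc _ _ _ |>.trans (mul_left_comm _ _ _)

theorem integral_norm_sq_ne_zero {φ : 𝓢(E, ℂ)} (hφ : φ ≠ 0) :
    (∫ t, ((‖φ t‖ ^ 2 : ℝ) : ℂ)) ≠ 0 := by
  rw [integral_complex_ofReal, Complex.ofReal_ne_zero]
  obtain ⟨t, ht⟩ : ∃ t, φ t ≠ 0 := by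
    by_contra! h
    exact hφ (by ext t; exact h t)
  have hc : Continuous fun t => ‖φ t‖ ^ 2 := φ.continuous.norm.pow 2
  refine (integral_pos_of_integrable_nonneg_nonzero (x := t) hc ?_ (fun _ => by positivity)
    (by simpa using ht)).ne'
  exact (memLp_two_iff_integrable_sq_norm φ.continuous.aestronglyMeasurable).1 (φ.memLp 2)

end atoms

/-! ### The pointwise factorization of V_Ψ(V_{f₁}f₂) -/

section identity

variable {E : Type} [NormedAddCommGroup E] [InnerProductSpace ℝ E] [FiniteDimensional ℝ E]
  [MeasurableSpace E] [BorelSpace E]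

theorem conjDist_conjS (f : 𝓢'(E, ℂ)) (ψ : 𝓢(E, ℂ)) :
    conjDist f (conjS ψ) = starRingEnd ℂ (f ψ) := by
  have : conjS (conjS ψ) = ψ := by ext x; simp
  change starRingEnd ℂ (f (conjS (conjS ψ))) = _
  rw [this]

theorem fourierConst_withLp :
    fourierConst (WithLp 2 (E × E)) = fourierConst E * fourierConst E := by
  have h : Module.finrank ℝ (WithLp 2 (E × E)) = Module.finrank ℝ E + Module.finrank ℝ E := by
    rw [(prodEquiv E).toLinearEquiv.finrank_eq, Module.finrank_prod]
  rw [fourierConst, fourierConst, h, ← Complex.ofReal_mul, ← Real.rpow_add (by positivity)]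
  congr 2
  push_cast; ring

theorem conj_cexp_neg_I (r : ℝ) :
    starRingEnd ℂ (Complex.exp (-(Complex.I * r))) = Complex.exp (Complex.I * r) := by
  rw [← Complex.exp_conj]; simp

theorem conj_cexp_I (r : ℝ) :
    starRingEnd ℂ (Complex.exp (Complex.I * r)) = Complex.exp (-(Complex.I * r)) := by
  rw [← Complex.exp_conj]; simp

theorem integral_conj_stftProd (φ f : 𝓢(E, ℂ)) (x t : E) :
    fourierConst E * ∫ ξ, starRingEnd ℂ (stftProd φ f (x, ξ))
        * Complex.exp (-(Complex.I * (inner ℝ t ξ : ℝ)))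
      = starRingEnd ℂ (f t) * φ (t - x) := by
  have h := congrArg (starRingEnd ℂ) (integral_stftProd φ f x t)
  rw [map_mul, conj_fourierConst, ← integral_conj, map_mul, Complex.conj_conj] at h
  simpa only [map_mul, conj_cexp_I] using h

/-- The atom is a shifted and modulated copy of the conjugate of V_{φ₁}φ₂, itself a partial Fourier
transform, so a further partial Fourier transform inverts it. The shift by ξ and the modulation by
(η, y) survive as phases and as the translation of t to y + t. -/
theorem partialFourier_stftAtom_schwartzSTFT (φ₁ φ₂ : 𝓢(E, ℂ)) (x ξ η y x' t : E) :
    partialFourier (SchwartzMap.compCLMOfContinuousLinearEquiv ℂ (prodEquiv E).symm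
      (stftAtom (schwartzSTFT φ₁ φ₂) (WithLp.toLp 2 (x, ξ)) (WithLp.toLp 2 (η, y)))) (x', t)
    = Complex.exp (-(Complex.I * (inner ℝ x' η : ℝ)))
      * Complex.exp (-(Complex.I * (inner ℝ (y + t) ξ : ℝ)))
      * (starRingEnd ℂ (φ₂ (y + t)) * φ₁ (y + t - (x' - x))) := by
  rw [partialFourier_apply, ← integral_conj_stftProd,
    ← integral_add_right_eq_self _ ξ, mul_left_comm _ (fourierConst E),
    ← integral_const_mul (_ * _)]
  congr 2
  funext s
  have h1 : SchwartzMap.compCLMOfContinuousLinearEquiv ℂ (prodEquiv E).symm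
      (stftAtom (schwartzSTFT φ₁ φ₂) (WithLp.toLp 2 (x, ξ)) (WithLp.toLp 2 (η, y))) (x', s + ξ)
      = Complex.exp (-(Complex.I * ((inner ℝ x' η + inner ℝ (s + ξ) y : ℝ) : ℂ)))
        * starRingEnd ℂ (stftProd φ₁ φ₂ (x' - x, s)) := by
    change stftAtom (schwartzSTFT φ₁ φ₂) (WithLp.toLp 2 (x, ξ)) (WithLp.toLp 2 (η, y))
      (WithLp.toLp 2 (x', s + ξ)) = _
    rw [stftAtom_apply, WithLp.prod_inner_apply]
    have : (WithLp.toLp 2 (x', s + ξ) - WithLp.toLp 2 (x, ξ) : WithLp 2 (E × E))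
        = WithLp.toLp 2 (x' - x, s) := by
      rw [← WithLp.toLp_sub]; simp
    rw [this, schwartzSTFT_toLp]
  rw [h1]
  have e : Complex.exp (-(Complex.I * ((inner ℝ x' η + inner ℝ (s + ξ) y : ℝ) : ℂ)))
      * Complex.exp (-(Complex.I * (inner ℝ (s + ξ) t : ℝ)))
      = Complex.exp (-(Complex.I * (inner ℝ x' η : ℝ)))
        * Complex.exp (-(Complex.I * (inner ℝ (y + t) ξ : ℝ)))
        * Complex.exp (-(Complex.I * (inner ℝ (y + t) s : ℝ))) := by
    rw [← Complex.exp_add, ← Complex.exp_add, ← Complex.exp_add]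
    congr 1
    simp only [inner_add_left, inner_add_right, real_inner_comm y, real_inner_comm t]
    push_cast; ring
  linear_combination starRingEnd ℂ (stftProd φ₁ φ₂ (x' - x, s)) * e

/-- The short-time Fourier transform of `V_{f₁} f₂` with window `V_{φ₁} φ₂` factorizes. -/
theorem norm_stft_schwartzSTFT_distSTFT (f₁ f₂ : 𝓢'(E, ℂ)) (φ₁ φ₂ : 𝓢(E, ℂ)) (x ξ η y : E) :
    ‖stft (schwartzSTFT φ₁ φ₂) (distSTFT f₁ f₂) (WithLp.toLp 2 (x, ξ), WithLp.toLp 2 (η, y))‖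
      = ‖stft φ₁ f₁ (-x - y, η)‖ * ‖stft φ₂ f₂ (-y, ξ + η)‖ := by
  set a₁ := stftAtom φ₁ (-x - y) η with ha₁
  set a₂ := stftAtom φ₂ (-y) (ξ + η) with ha₂
  set G := SchwartzMap.compCLMOfContinuousLinearEquiv ℂ (shear E).symm
    (partialFourier (SchwartzMap.compCLMOfContinuousLinearEquiv ℂ (prodEquiv E).symm
      (stftAtom (schwartzSTFT φ₁ φ₂) (WithLp.toLp 2 (x, ξ)) (WithLp.toLp 2 (η, y))))) with hG
  -- After the shear the transposed test function separates into an atom in t and a conjugated atom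
  -- in u; the phases in t and u match those of the atoms and only a constant phase remains.
  have hGa : ∀ t u, G (t, u)
      = Complex.exp (-(Complex.I * (inner ℝ y ξ : ℝ))) * a₂ t * conjS a₁ u := by
    intro t u
    have h0 : G (t, u) = partialFourier (SchwartzMap.compCLMOfContinuousLinearEquiv ℂ
        (prodEquiv E).symm (stftAtom (schwartzSTFT φ₁ φ₂) (WithLp.toLp 2 (x, ξ))
          (WithLp.toLp 2 (η, y)))) (t - u, t) := rfl
    rw [h0, partialFourier_stftAtom_schwartzSTFT, conjS_apply, ha₁, ha₂, stftAtom_apply,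
      stftAtom_apply, map_mul, conj_cexp_neg_I, Complex.conj_conj,
      show y + t - (t - u - x) = u - (-x - y) by abel, show y + t = t - -y by abel]
    have e : Complex.exp (-(Complex.I * (inner ℝ (t - u) η : ℝ)))
        * Complex.exp (-(Complex.I * (inner ℝ (t - -y) ξ : ℝ)))
        = Complex.exp (-(Complex.I * (inner ℝ y ξ : ℝ)))
          * Complex.exp (-(Complex.I * (inner ℝ t (ξ + η) : ℝ)))
          * Complex.exp (Complex.I * (inner ℝ u η : ℝ)) := by
      rw [← Complex.exp_add, ← Complex.exp_add, ← Complex.exp_add]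
      congr 1
      simp only [inner_sub_left, inner_neg_left, inner_add_right]
      push_cast; ring
    linear_combination (starRingEnd ℂ (φ₂ (t - -y)) * φ₁ (u - (-x - y))) * e
  have hP : partialApply (conjDist f₁) G
      = (Complex.exp (-(Complex.I * (inner ℝ y ξ : ℝ))) * starRingEnd ℂ (f₁ a₁)) • a₂ := by
    ext t
    have hs : slice t G = (Complex.exp (-(Complex.I * (inner ℝ y ξ : ℝ))) * a₂ t) • conjS a₁ := by
      ext u
      rw [slice_apply, hGa]; rfl
    rw [partialApply_apply, hs, map_smul, conjDist_conjS, smul_apply, smul_eq_mul, smul_eq_mul]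
    ring
  have hD : distSTFT f₁ f₂
      (stftAtom (schwartzSTFT φ₁ φ₂) (WithLp.toLp 2 (x, ξ)) (WithLp.toLp 2 (η, y)))
      = (Complex.exp (-(Complex.I * (inner ℝ y ξ : ℝ))) * starRingEnd ℂ (f₁ a₁)) * f₂ a₂ := by
    rw [distSTFT_apply, ← hG, hP]
    exact map_smul f₂ _ a₂
  simp only [stft]
  rw [hD, fourierConst_withLp]
  simp only [norm_mul, norm_cexp_neg_I, RCLike.norm_conj]
  ring

end identity

/-! ### Mixed norms of [0, ∞]-valued functions -/

section mixed

variable {X : Type} [MeasureSpace X]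

/-- The mixed norm of an `[0, ∞]`-valued function: first in the first variable, then in the
second. -/
noncomputable def mixedLpNorm (p q : ℝ≥0∞) (F : X × X → ℝ≥0∞) : ℝ≥0∞ :=
  eLpNorm (fun ξ : X => eLpNorm (fun x : X => F (x, ξ)) p volume) q volume

theorem mixedNorm₁_eq (p q : ℝ≥0∞) (ω : X × X → ℝ) (F : X × X → ℂ) :
    mixedNorm₁ p q ω F = mixedLpNorm p q fun z => ‖F z * (ω z : ℂ)‖ₑ := by
  simp only [mixedLpNorm, eLpNorm_enorm]; rfl

/-- Exchanging variables and exponents puts the W^{q,p} norm into the same form as the M^{p,q} norm,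
so one mixed norm serves for both factors. -/
theorem mixedNorm₂_eq (p q : ℝ≥0∞) (ω : X × X → ℝ) (F : X × X → ℂ) :
    mixedNorm₂ p q ω F = mixedLpNorm q p fun z => ‖F z.swap * (ω z.swap : ℂ)‖ₑ := by
  simp only [mixedLpNorm, eLpNorm_enorm]; rfl

theorem mixedLpNorm_mono (p q : ℝ≥0∞) {F G : X × X → ℝ≥0∞} (h : ∀ z, F z ≤ G z) :
    mixedLpNorm p q F ≤ mixedLpNorm p q G :=
  eLpNorm_mono_enorm fun ξ => eLpNorm_mono_enorm fun x => h (x, ξ)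

variable [SFinite (volume : Measure X)]

theorem mixedLpNorm_const_mul (p q a : ℝ≥0∞) {F : X × X → ℝ≥0∞} (hF : Measurable F) :
    mixedLpNorm p q (fun z => a * F z) = a * mixedLpNorm p q F := by
  have h : ∀ ξ, Measurable fun x => F (x, ξ) := fun ξ => by fun_prop
  simp only [mixedLpNorm, eLpNorm_ennreal_const_mul a p (h _)]
  exact eLpNorm_ennreal_const_mul a q (measurable_eLpNorm_left p hF)

end mixed

/-! ### Factorization of the mixed norm on phase space -/

section product

variable {E : Type} [NormedAddCommGroup E] [InnerProductSpace ℝ E] [FiniteDimensional ℝ E]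
  [MeasurableSpace E] [BorelSpace E]

theorem eLpNorm_withLp_mul (p : ℝ≥0∞) {f g : E → ℝ≥0∞} (hf : Measurable f) (hg : Measurable g) :
    eLpNorm (fun z : WithLp 2 (E × E) => f z.fst * g z.snd) p volume
      = eLpNorm f p volume * eLpNorm g p volume := by
  rw [← eLpNorm_prod_mul p hf hg, ← Measure.volume_eq_prod,
    ← eLpNorm_comp_measurePreserving (g := fun z : E × E => f z.1 * g z.2)
      (Measurable.aestronglyMeasurable (by fun_prop)) (WithLp.volume_preserving_ofLp E E)]
  rfl

theorem eLpNorm_comp_sub_left (p : ℝ≥0∞) {f : E → ℝ≥0∞} (hf : Measurable f) (a : E) :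
    eLpNorm (fun x => f (a - x)) p volume = eLpNorm f p volume :=
  eLpNorm_comp_measurePreserving hf.aestronglyMeasurable (Measure.measurePreserving_sub_left volume a)

theorem eLpNorm_comp_add_right (p : ℝ≥0∞) {f : E → ℝ≥0∞} (hf : Measurable f) (a : E) :
    eLpNorm (fun x => f (x + a)) p volume = eLpNorm f p volume :=
  eLpNorm_comp_measurePreserving hf.aestronglyMeasurable (measurePreserving_add_right volume a)

/-- At fixed (η, y) the inner norm splits into norms in x and in ξ. The substitution x ↦ -y - x
frees the first from y, and the translation of ξ by η frees the second from η. The result is a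
product in η and y, so the outer norm splits as well. -/
theorem mixedLpNorm_tensor (p q : ℝ≥0∞) {a b : E × E → ℝ≥0∞} (ha : Measurable a)
    (hb : Measurable b) :
    mixedLpNorm p q (fun Z : WithLp 2 (E × E) × WithLp 2 (E × E) =>
      a (-Z.1.fst - Z.2.snd, Z.2.fst) * b (-Z.2.snd, Z.1.snd + Z.2.fst))
    = mixedLpNorm p q a * mixedLpNorm p q (fun z => b z.swap) := by
  have h1 : ∀ Ξ : WithLp 2 (E × E), eLpNorm (fun Z : WithLp 2 (E × E) =>
      a (-Z.fst - Ξ.snd, Ξ.fst) * b (-Ξ.snd, Z.snd + Ξ.fst)) p volume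
      = eLpNorm (fun x => a (x, Ξ.fst)) p volume
        * eLpNorm (fun ξ => b (0 - Ξ.snd, ξ)) p volume := by
    intro Ξ
    have e1 := eLpNorm_withLp_mul (E := E) p (f := fun x => a (-x - Ξ.snd, Ξ.fst))
      (g := fun ξ => b (-Ξ.snd, ξ + Ξ.fst)) (by fun_prop) (by fun_prop)
    refine e1.trans ?_
    congr 1
    · rw [← eLpNorm_comp_sub_left p (f := fun x => a (x, Ξ.fst)) (by fun_prop) (-Ξ.snd)]
      congr 1; funext x
      rw [show -x - Ξ.snd = -Ξ.snd - x by abel]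
    · rw [← eLpNorm_comp_add_right p (f := fun ξ => b (0 - Ξ.snd, ξ)) (by fun_prop) Ξ.fst, zero_sub]
  have hA : Measurable fun η => eLpNorm (fun x => a (x, η)) p (volume : Measure E) :=
    measurable_eLpNorm_left p ha
  have hB : Measurable fun y => eLpNorm (fun ξ => b (y, ξ)) p (volume : Measure E) :=
    measurable_eLpNorm_left (h := fun z : E × E => b (z.2, z.1)) p (by fun_prop)
  unfold mixedLpNorm
  simp only [h1]
  refine (eLpNorm_withLp_mul (E := E) q (f := fun η => eLpNorm (fun x => a (x, η)) p volume)
    (g := fun y => eLpNorm (fun ξ => b (0 - y, ξ)) p volume) hA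
    (hB.comp (measurable_const.sub measurable_id))).trans ?_
  congr 1
  -- Writing the reflection as 0 - y makes it an instance of the invariance under y ↦ a - y.
  exact eLpNorm_comp_sub_left q hB 0

end product

/-! ### Young's inequality, change of window, and comparison of norms -/

section windows

variable {E : Type} [NormedAddCommGroup E] [InnerProductSpace ℝ E] [FiniteDimensional ℝ E]
  [MeasurableSpace E] [BorelSpace E]

/-- **Young's inequality** for mixed norms. -/
theorem mixedLpNorm_convolution_le {p q : ℝ≥0∞} (hp : 1 ≤ p) (hq : 1 ≤ q) {G k : E × E → ℝ≥0∞}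
    (hG : Measurable G) (hk : Measurable k) :
    mixedLpNorm p q (fun X => ∫⁻ Y, k Y * G (X - Y)) ≤ (∫⁻ Y, k Y) * mixedLpNorm p q G := by
  set g : E → ℝ≥0∞ := fun ξ => eLpNorm (fun x => G (x, ξ)) p volume with hg
  have hgm : Measurable g := measurable_eLpNorm_left p hG
  -- Minkowski in the space variable and translation invariance leave only a shift by `Y.2` in
  -- frequency; a second Minkowski inequality removes that one.
  have h1 : ∀ ξ : E, eLpNorm (fun x : E => ∫⁻ Y : E × E, k Y * G ((x, ξ) - Y)) p volume
      ≤ ∫⁻ Y : E × E, k Y * g (ξ - Y.2) := by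
    intro ξ
    refine (eLpNorm_lintegral_le (ν := volume) hp
      (h := fun z : E × (E × E) => k z.2 * G ((z.1, ξ) - z.2)) (by fun_prop)).trans ?_
    refine (lintegral_congr fun Y => ?_).le
    have e := eLpNorm_ennreal_const_mul (μ := volume) (k Y) p
      (f := fun x : E => G ((x, ξ) - Y)) (by fun_prop)
    refine e.trans ?_
    congr 1
    have e2 := eLpNorm_comp_add_right p (f := fun x : E => G (x, ξ - Y.2)) (by fun_prop) (-Y.1)
    rw [hg]
    refine Eq.trans ?_ e2
    congr 1
    funext x
    congr 1
    ext <;> simp [sub_eq_add_neg]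
  have h2 : mixedLpNorm p q (fun X => ∫⁻ Y, k Y * G (X - Y))
      ≤ eLpNorm (fun ξ => ∫⁻ Y : E × E, k Y * g (ξ - Y.2)) q volume :=
    eLpNorm_mono_enorm h1
  refine h2.trans ((eLpNorm_lintegral_le (ν := volume) hq
    (h := fun z : E × (E × E) => k z.2 * g (z.1 - z.2.2)) (by fun_prop)).trans ?_)
  rw [← lintegral_mul_const _ hk]
  refine (lintegral_congr fun Y => ?_).le
  refine (eLpNorm_ennreal_const_mul (μ := volume) (k Y) q
    (f := fun ξ : E => g (ξ - Y.2)) (by fun_prop)).trans ?_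
  congr 1
  have e2 := eLpNorm_comp_add_right q hgm (-Y.2)
  simp only [sub_eq_add_neg]
  exact e2

theorem mixedLpNorm_eq_zero {p q : ℝ≥0∞} (hp : p ≠ 0) (hq : q ≠ 0) {G : E × E → ℝ≥0∞}
    (hG : Measurable G) (h : mixedLpNorm p q G = 0) : ∀ᵐ z : E × E, G z = 0 := by
  have hgm : Measurable fun ξ => eLpNorm (fun x => G (x, ξ)) p (volume : Measure E) :=
    measurable_eLpNorm_left p hG
  rw [mixedLpNorm, eLpNorm_eq_zero_iff hgm.aestronglyMeasurable hq] at h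
  have h1 : ∀ᵐ ξ : E, ∀ᵐ x : E, G (x, ξ) = 0 := by
    filter_upwards [h] with ξ hξ
    have hm : Measurable fun x => G (x, ξ) := by fun_prop
    exact (eLpNorm_eq_zero_iff hm.aestronglyMeasurable hp).1 hξ
  rw [Measure.ae_ae_comm (p := fun ξ x => G (x, ξ) = 0)
    (measurableSet_eq_fun (by fun_prop) measurable_const)] at h1
  rw [Measure.volume_eq_prod]
  exact (Measure.ae_prod_mem_iff_ae_ae_mem (measurableSet_eq_fun hG measurable_const)).2 h1

/-- If φ(s) and f(t) are nonzero, inversion at x = t - s yields f(t) conj φ(s) ≠ 0. This makes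
V_{χ₁}χ₂ an admissible window. -/
theorem stftProd_ne_zero {φ f : 𝓢(E, ℂ)} (hφ : φ ≠ 0) (hf : f ≠ 0) :
    ∃ z, stftProd φ f z ≠ 0 := by
  obtain ⟨s, hs⟩ : ∃ s, φ s ≠ 0 := by
    by_contra! h
    exact hφ (by ext t; exact h t)
  obtain ⟨t, ht⟩ : ∃ t, f t ≠ 0 := by
    by_contra! h
    exact hf (by ext t; exact h t)
  by_contra! h
  have h1 := integral_stftProd φ f (t - s) t
  simp only [h, zero_mul, integral_zero, mul_zero, sub_sub_cancel] at h1
  have : starRingEnd ℂ (φ s) ≠ 0 := by simpa using hs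
  exact mul_ne_zero ht this h1.symm

theorem eq_zero_of_stft_ae_eq_zero {φ : 𝓢(E, ℂ)} (hφ : φ ≠ 0) {f : 𝓢'(E, ℂ)}
    (h : ∀ᵐ z : E × E, stft φ f z = 0) : f = 0 := by
  have key : ∀ ψ, f ψ = 0 := fun ψ => by
    have h1 := reproducing_formula φ ψ f
    have h2 : ∫ p : E × E, stftProd (conjS φ) ψ (p.1, -p.2) * stft φ f p = 0 :=
      integral_eq_zero_of_ae (h.mono fun z hz => by simp [hz])
    rw [h2] at h1
    exact (mul_eq_zero.1 h1).resolve_left (integral_norm_sq_ne_zero hφ)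
  ext ψ
  exact key ψ

/-- The reproducing formula is applied to the atom at X; its kernel has modulus |V_χ φ| at the
difference of the phase-space points. The constant depends only on φ and the normalization, not on
f. -/
theorem enorm_stft_le {φ : 𝓢(E, ℂ)} (hφ : φ ≠ 0) (χ : 𝓢(E, ℂ)) :
    ∃ A : ℝ≥0∞, A ≠ ∞ ∧ ∀ (f : 𝓢'(E, ℂ)) (X : E × E),
      ‖stft χ f X‖ₑ ≤ A * ∫⁻ Y, ‖stftProd χ φ Y‖ₑ * ‖stft φ f (X - Y)‖ₑ := by
  set M : ℂ := ∫ t, ((‖φ t‖ ^ 2 : ℝ) : ℂ) with hM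
  refine ⟨‖fourierConst E * M⁻¹‖ₑ, enorm_ne_top, fun f X => ?_⟩
  have h1 := reproducing_formula φ (stftAtom χ X.1 X.2) f
  have h2 : stft χ f X = (fourierConst E * M⁻¹) * (M * f (stftAtom χ X.1 X.2)) := by
    rw [stft, mul_assoc, inv_mul_cancel_left₀ (integral_norm_sq_ne_zero hφ)]
  rw [h2, h1, enorm_mul]
  gcongr
  refine (enorm_integral_le_lintegral_enorm _).trans (le_of_eq ?_)
  have hv : (volume : Measure (E × E)).IsAddHaarMeasure :=
    inferInstanceAs ((volume : Measure E).prod volume).IsAddHaarMeasure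
  rw [← lintegral_sub_left_eq_self _ X]
  refine lintegral_congr fun Y => ?_
  have e : (X.1 - (X - Y).1, X.2 - (X - Y).2) = Y := by ext <;> simp
  rw [enorm_mul]
  congr 1
  rw [← ofReal_norm, ← ofReal_norm, norm_stftProd_stftAtom, e]

theorem lintegral_schwartz_mul_pow_lt_top (S : 𝓢(E × E, ℂ)) (C : ℝ) (N : ℕ) :
    ∫⁻ Z : E × E, ‖S Z‖ₑ * ENNReal.ofReal (C * (1 + ‖Z‖) ^ N) ≠ ∞ := by
  have hv : (volume : Measure (E × E)).IsAddHaarMeasure :=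
    inferInstanceAs ((volume : Measure E).prod volume).IsAddHaarMeasure
  set r := (volume : Measure (E × E)).integrablePower with hr
  set D := 2 ^ (N + r) * (Finset.Iic (N + r, 0)).sup
    (fun m => SchwartzMap.seminorm ℝ m.1 m.2) S
  have hi : Integrable fun Z : E × E => |C| * D * (1 + ‖Z‖) ^ (-(r : ℝ)) :=
    (Measure.integrable_pow_neg_integrablePower (volume : Measure (E × E))).const_mul _
  refine ((lintegral_mono fun Z => ?_).trans_lt hi.lintegral_lt_top).ne
  rw [← ofReal_norm, ← ENNReal.ofReal_mul (norm_nonneg _)]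
  refine ENNReal.ofReal_le_ofReal ?_
  have h := SchwartzMap.one_add_le_sup_seminorm_apply (𝕜 := ℝ) (m := (N + r, 0)) (k := N + r)
    (n := 0) le_rfl le_rfl S Z
  rw [norm_iteratedFDeriv_zero] at h
  rw [Real.rpow_neg (by positivity), Real.rpow_natCast, ← div_eq_mul_inv,
    le_div_iff₀ (by positivity)]
  calc ‖S Z‖ * (C * (1 + ‖Z‖) ^ N) * (1 + ‖Z‖) ^ r
      = C * ((1 + ‖Z‖) ^ (N + r) * ‖S Z‖) := by rw [pow_add]; ring
    _ ≤ |C| * ((1 + ‖Z‖) ^ (N + r) * ‖S Z‖) := mul_le_mul_of_nonneg_right (le_abs_self C) (by positivity)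
    _ ≤ |C| * D := mul_le_mul_of_nonneg_left h (abs_nonneg C)

/-- Moderateness gives ω(X) ≤ C (1 + ‖Y‖)^N ω(X - Y), so the weight moves inside the convolution.
The polynomial is absorbed by the Schwartz kernel, which stays integrable. -/
theorem weighted_stft_le {ω : E × E → ℝ} (hω : PolyModerate ω) {φ : 𝓢(E, ℂ)} (hφ : φ ≠ 0)
    (χ : 𝓢(E, ℂ)) :
    ∃ k : E × E → ℝ≥0∞, Measurable k ∧ ∫⁻ Y, k Y ≠ ∞ ∧ ∀ (f : 𝓢'(E, ℂ)) (X : E × E),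
      ‖stft χ f X * (ω X : ℂ)‖ₑ ≤ ∫⁻ Y, k Y * ‖stft φ f (X - Y) * (ω (X - Y) : ℂ)‖ₑ := by
  obtain ⟨A, hA, h⟩ := enorm_stft_le hφ χ
  obtain ⟨C, N, hC⟩ := hω.moderate
  have hkm : Measurable fun Z : E × E =>
      ‖stftProd χ φ Z‖ₑ * ENNReal.ofReal (C * (1 + ‖Z‖) ^ N) := by
    have := (stftProd χ φ).continuous.measurable
    fun_prop
  refine ⟨fun Z => A * (‖stftProd χ φ Z‖ₑ * ENNReal.ofReal (C * (1 + ‖Z‖) ^ N)),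
    hkm.const_mul A, ?_, fun f X => ?_⟩
  · rw [lintegral_const_mul _ hkm]
    exact ENNReal.mul_ne_top hA (lintegral_schwartz_mul_pow_lt_top _ C N)
  have hωe : ∀ Y, ‖(ω Y : ℂ)‖ₑ = ENNReal.ofReal (ω Y) := fun Y => by
    rw [← ofReal_norm, Complex.norm_real, Real.norm_of_nonneg (hω.pos Y).le]
  have hm : Measurable fun Y => ‖stftProd χ φ Y‖ₑ * ‖stft φ f (X - Y)‖ₑ := by
    have h1 := (stftProd χ φ).continuous.measurable
    have h2 := (continuous_stft φ f).measurable
    fun_prop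
  rw [enorm_mul]
  refine (mul_le_mul_left (h f X) _).trans ?_
  rw [← lintegral_const_mul _ hm, ← lintegral_mul_const _ (hm.const_mul A)]
  refine lintegral_mono fun Y => ?_
  have hωX : ‖(ω X : ℂ)‖ₑ
      ≤ ENNReal.ofReal (C * (1 + ‖Y‖) ^ N) * ‖(ω (X - Y) : ℂ)‖ₑ := by
    rw [hωe, hωe, ← ENNReal.ofReal_mul' (hω.pos _).le]
    refine ENNReal.ofReal_le_ofReal ?_
    have := hC (X - Y) Y
    rw [sub_add_cancel] at this
    linarith
  rw [enorm_mul]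
  calc A * (‖stftProd χ φ Y‖ₑ * ‖stft φ f (X - Y)‖ₑ) * ‖(ω X : ℂ)‖ₑ
      ≤ A * (‖stftProd χ φ Y‖ₑ * ‖stft φ f (X - Y)‖ₑ)
        * (ENNReal.ofReal (C * (1 + ‖Y‖) ^ N) * ‖(ω (X - Y) : ℂ)‖ₑ) := by gcongr
    _ = _ := by ring

theorem measurable_enorm_stft_mul {ω : E × E → ℝ} (hω : PolyModerate ω) (φ : 𝓢(E, ℂ))
    (f : 𝓢'(E, ℂ)) : Measurable fun z => ‖stft φ f z * (ω z : ℂ)‖ₑ := by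
  have h1 := (continuous_stft φ f).measurable
  have h2 := hω.measurable
  fun_prop

/-- Young's inequality for the weighted domination; K is the L¹ norm of the kernel and hence
independent of f. -/
theorem modNorm_le_mul_modNorm {p q : ℝ≥0∞} (hp : 1 ≤ p) (hq : 1 ≤ q) {ω : E × E → ℝ}
    (hω : PolyModerate ω) {φ : 𝓢(E, ℂ)} (hφ : φ ≠ 0) (χ : 𝓢(E, ℂ)) :
    ∃ K : ℝ≥0∞, K ≠ ∞ ∧ ∀ f : 𝓢'(E, ℂ), modNorm p q ω χ f ≤ K * modNorm p q ω φ f := by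
  obtain ⟨k, hk, hkt, h⟩ := weighted_stft_le hω hφ χ
  refine ⟨∫⁻ Y, k Y, hkt, fun f => ?_⟩
  rw [modNorm, modNorm, mixedNorm₁_eq, mixedNorm₁_eq]
  exact (mixedLpNorm_mono p q (h f)).trans
    (mixedLpNorm_convolution_le (G := fun z => ‖stft φ f z * (ω z : ℂ)‖ₑ) hp hq
      (measurable_enorm_stft_mul hω φ f) hk)

theorem modNorm_ne_zero {p q : ℝ≥0∞} (hp : 1 ≤ p) (hq : 1 ≤ q) {ω : E × E → ℝ}
    (hω : PolyModerate ω) {φ : 𝓢(E, ℂ)} (hφ : φ ≠ 0) {f : 𝓢'(E, ℂ)} (hf : f ≠ 0) :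
    modNorm p q ω φ f ≠ 0 := by
  intro h
  rw [modNorm, mixedNorm₁_eq] at h
  refine hf (eq_zero_of_stft_ae_eq_zero hφ ((mixedLpNorm_eq_zero (zero_lt_one.trans_le hp).ne'
    (zero_lt_one.trans_le hq).ne' (measurable_enorm_stft_mul hω φ f) h).mono fun z hz => ?_))
  simpa [(hω.pos z).ne'] using hz

theorem wienerNorm_ne_zero {p q : ℝ≥0∞} (hp : 1 ≤ p) (hq : 1 ≤ q) {ω : E × E → ℝ}
    (hω : PolyModerate ω) {φ : 𝓢(E, ℂ)} (hφ : φ ≠ 0) {f : 𝓢'(E, ℂ)} (hf : f ≠ 0) :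
    wienerNorm p q ω φ f ≠ 0 := by
  intro h
  rw [wienerNorm, mixedNorm₂_eq] at h
  have h1 := mixedLpNorm_eq_zero (zero_lt_one.trans_le hq).ne' (zero_lt_one.trans_le hp).ne'
    ((measurable_enorm_stft_mul hω φ f).comp measurable_swap) h
  have h2 := (Measure.measurePreserving_swap (μ := (volume : Measure E))
      (ν := (volume : Measure E))).quasiMeasurePreserving.ae h1
  refine hf (eq_zero_of_stft_ae_eq_zero hφ (h2.mono fun z hz => ?_))
  simpa [(hω.pos z).ne'] using hz

variable {ω₀ : WithLp 2 (E × E) × WithLp 2 (E × E) → ℝ} {ω₁ ω₂ : E × E → ℝ}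

/-- The factorization of the transform and that of the mixed norm combine into an equality valid
without any relation to ω₀. Both weight comparisons are then pointwise. -/
theorem mixedNorm_mul_eq (hω₁ : PolyModerate ω₁) (hω₂ : PolyModerate ω₂) (p q : ℝ≥0∞)
    (f₁ f₂ : 𝓢'(E, ℂ)) (φ₁ φ₂ : 𝓢(E, ℂ)) :
    mixedNorm₁ p q ω₁ (stft φ₁ f₁) * mixedNorm₂ q p ω₂ (stft φ₂ f₂)
      = mixedLpNorm p q (fun Z : WithLp 2 (E × E) × WithLp 2 (E × E) =>
        ‖stft (schwartzSTFT φ₁ φ₂) (distSTFT f₁ f₂) Z‖ₑ * ENNReal.ofReal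
          (ω₁ (-Z.1.fst - Z.2.snd, Z.2.fst) * ω₂ (-Z.2.snd, Z.1.snd + Z.2.fst))) := by
  rw [mixedNorm₁_eq, mixedNorm₂_eq,
    ← mixedLpNorm_tensor p q (measurable_enorm_stft_mul hω₁ φ₁ f₁)
      (b := fun z => ‖stft φ₂ f₂ z * (ω₂ z : ℂ)‖ₑ) (measurable_enorm_stft_mul hω₂ φ₂ f₂)]
  congr 1
  funext Z
  have h := norm_stft_schwartzSTFT_distSTFT f₁ f₂ φ₁ φ₂ Z.1.fst Z.1.snd Z.2.fst Z.2.snd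
  have hZ : (WithLp.toLp 2 (Z.1.fst, Z.1.snd), WithLp.toLp 2 (Z.2.fst, Z.2.snd)) = Z := rfl
  rw [hZ] at h
  simp only [← ofReal_norm, norm_mul, h, Complex.norm_real, Real.norm_of_nonneg (hω₁.pos _).le,
    Real.norm_of_nonneg (hω₂.pos _).le]
  rw [← ENNReal.ofReal_mul (by have := hω₁.pos (-Z.1.fst - Z.2.snd, Z.2.fst); positivity),
    ← ENNReal.ofReal_mul (by positivity)]
  congr 1
  ring

theorem mixedNorm_stft_distSTFT_le (hω₀ : PolyModerate ω₀) (hω₁ : PolyModerate ω₁)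
    (hω₂ : PolyModerate ω₂) (p q : ℝ≥0∞) (f₁ f₂ : 𝓢'(E, ℂ)) (φ₁ φ₂ : 𝓢(E, ℂ)) (C : ℝ)
    (h : ∀ x ξ η y : E, ω₀ (WithLp.toLp 2 (x, ξ), WithLp.toLp 2 (η, y))
      ≤ C * ω₁ (-x - y, η) * ω₂ (-y, ξ + η)) :
    mixedNorm₁ p q ω₀ (stft (schwartzSTFT φ₁ φ₂) (distSTFT f₁ f₂)) ≤ ENNReal.ofReal C *
      (mixedNorm₁ p q ω₁ (stft φ₁ f₁) * mixedNorm₂ q p ω₂ (stft φ₂ f₂)) := by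
  have hm : Measurable fun Z : WithLp 2 (E × E) × WithLp 2 (E × E) =>
      ‖stft (schwartzSTFT φ₁ φ₂) (distSTFT f₁ f₂) Z‖ₑ * ENNReal.ofReal
        (ω₁ (-Z.1.fst - Z.2.snd, Z.2.fst) * ω₂ (-Z.2.snd, Z.1.snd + Z.2.fst)) := by
    have h0 := (continuous_stft (schwartzSTFT φ₁ φ₂) (distSTFT f₁ f₂)).measurable
    have h1 := hω₁.measurable
    have h2 := hω₂.measurable
    fun_prop
  rw [mixedNorm_mul_eq hω₁ hω₂, mixedNorm₁_eq, ← mixedLpNorm_const_mul p q _ hm]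
  refine mixedLpNorm_mono p q fun Z => ?_
  have hZ := h Z.1.fst Z.1.snd Z.2.fst Z.2.snd
  rw [enorm_mul, mul_left_comm, ← ofReal_norm (ω₀ Z : ℂ), Complex.norm_real,
    Real.norm_of_nonneg (hω₀.pos Z).le,
    ← ENNReal.ofReal_mul' (mul_pos (hω₁.pos _) (hω₂.pos _)).le, ← mul_assoc C]
  gcongr
  exact hZ

theorem mixedNorm_mul_le (hω₀ : PolyModerate ω₀) (hω₁ : PolyModerate ω₁)
    (hω₂ : PolyModerate ω₂) (p q : ℝ≥0∞) (f₁ f₂ : 𝓢'(E, ℂ)) (φ₁ φ₂ : 𝓢(E, ℂ)) (C : ℝ)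
    (h : ∀ x ξ η y : E, ω₁ (-x - y, η) * ω₂ (-y, ξ + η)
      ≤ C * ω₀ (WithLp.toLp 2 (x, ξ), WithLp.toLp 2 (η, y))) :
    mixedNorm₁ p q ω₁ (stft φ₁ f₁) * mixedNorm₂ q p ω₂ (stft φ₂ f₂) ≤ ENNReal.ofReal C *
      mixedNorm₁ p q ω₀ (stft (schwartzSTFT φ₁ φ₂) (distSTFT f₁ f₂)) := by
  rw [mixedNorm_mul_eq hω₁ hω₂, mixedNorm₁_eq,
    ← mixedLpNorm_const_mul p q _ (measurable_enorm_stft_mul hω₀ _ _)]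
  refine mixedLpNorm_mono p q fun Z => ?_
  have hZ := h Z.1.fst Z.1.snd Z.2.fst Z.2.snd
  rw [enorm_mul, mul_left_comm, ← ofReal_norm (ω₀ Z : ℂ), Complex.norm_real,
    Real.norm_of_nonneg (hω₀.pos Z).le, ← ENNReal.ofReal_mul' (hω₀.pos Z).le]
  exact mul_le_mul_right (ENNReal.ofReal_le_ofReal hZ) _

/-- For arbitrary windows, the norm of `V_{f₁} f₂` is comparable to the product of the norms of `f₁`
and `f₂`. -/
theorem modNorm_distSTFT_equiv {p q : ℝ≥0∞} (hp : 1 ≤ p) (hq : 1 ≤ q) (hω₀ : PolyModerate ω₀)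
    (hω₁ : PolyModerate ω₁) (hω₂ : PolyModerate ω₂) {C₁ C₂ : ℝ}
    (h₁ : ∀ x ξ η y : E, ω₀ (WithLp.toLp 2 (x, ξ), WithLp.toLp 2 (η, y))
      ≤ C₁ * ω₁ (-x - y, η) * ω₂ (-y, ξ + η))
    (h₂ : ∀ x ξ η y : E, ω₁ (-x - y, η) * ω₂ (-y, ξ + η)
      ≤ C₂ * ω₀ (WithLp.toLp 2 (x, ξ), WithLp.toLp 2 (η, y)))
    {χ₁ χ₂ : 𝓢(E, ℂ)} {Φ : 𝓢(WithLp 2 (E × E), ℂ)} (hχ₁ : χ₁ ≠ 0) (hχ₂ : χ₂ ≠ 0) (hΦ : Φ ≠ 0) :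
    ∃ C : ℝ, 0 < C ∧ ∀ f₁ f₂ : 𝓢'(E, ℂ),
      modNorm p q ω₀ Φ (distSTFT f₁ f₂)
        ≤ ENNReal.ofReal C * (modNorm p q ω₁ χ₁ f₁ * wienerNorm q p ω₂ χ₂ f₂) ∧
      modNorm p q ω₁ χ₁ f₁ * wienerNorm q p ω₂ χ₂ f₂
        ≤ ENNReal.ofReal C * modNorm p q ω₀ Φ (distSTFT f₁ f₂) := by
  -- With Ψ = V_{χ₁}χ₂ the windows of f₁ and f₂ are already the prescribed ones, so only Φ and Ψ
  -- have to be compared, in both directions.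
  have hΨ : schwartzSTFT χ₁ χ₂ ≠ 0 := by
    obtain ⟨z, hz⟩ := stftProd_ne_zero hχ₁ hχ₂
    intro h
    rw [← schwartzSTFT_toLp, h] at hz
    exact hz rfl
  obtain ⟨K₁, hK₁, hb₁⟩ := modNorm_le_mul_modNorm hp hq hω₀ hΨ Φ
  obtain ⟨K₂, hK₂, hb₂⟩ := modNorm_le_mul_modNorm hp hq hω₀ hΦ (schwartzSTFT χ₁ χ₂)
  have ht₁ : K₁ * ENNReal.ofReal C₁ ≠ ∞ := ENNReal.mul_ne_top hK₁ ENNReal.ofReal_ne_top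
  have ht₂ : ENNReal.ofReal C₂ * K₂ ≠ ∞ := ENNReal.mul_ne_top ENNReal.ofReal_ne_top hK₂
  -- The sum dominates both constants, and the added 1 makes it positive.
  set L : ℝ := (K₁ * ENNReal.ofReal C₁).toReal + (ENNReal.ofReal C₂ * K₂).toReal + 1 with hL
  have hL₁ : K₁ * ENNReal.ofReal C₁ ≤ ENNReal.ofReal L := by
    rw [← ENNReal.ofReal_toReal ht₁]
    exact ENNReal.ofReal_le_ofReal (by
      have := (ENNReal.ofReal C₂ * K₂).toReal_nonneg; linarith)
  have hL₂ : ENNReal.ofReal C₂ * K₂ ≤ ENNReal.ofReal L := by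
    rw [← ENNReal.ofReal_toReal ht₂]
    exact ENNReal.ofReal_le_ofReal (by
      have := (K₁ * ENNReal.ofReal C₁).toReal_nonneg; linarith)
  refine ⟨L, by positivity, fun f₁ f₂ => ⟨?_, ?_⟩⟩
  · refine (hb₁ _).trans (le_trans ?_ (mul_le_mul_left hL₁ _))
    rw [mul_assoc]
    gcongr
    exact mixedNorm_stft_distSTFT_le hω₀ hω₁ hω₂ p q f₁ f₂ χ₁ χ₂ C₁ h₁
  · refine le_trans ?_ (mul_le_mul_left hL₂ _)
    rw [mul_assoc]
    refine (mixedNorm_mul_le hω₀ hω₁ hω₂ p q f₁ f₂ χ₁ χ₂ C₂ h₂).trans ?_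
    gcongr
    exact hb₂ _

end windows

end TF

/-! ### The proposition -/

theorem proposition5p2 (d : ℕ) (p q : ℝ≥0∞) (hp : 1 ≤ p) (hq : 1 ≤ q)
    (ω₀ : TF.R2d d × TF.R2d d → ℝ) (ω₁ ω₂ : TF.Rd d × TF.Rd d → ℝ)
    (hω₀ : TF.PolyModerate ω₀) (hω₁ : TF.PolyModerate ω₁) (hω₂ : TF.PolyModerate ω₂) :
    -- (1)
    (∀ (f₁ f₂ : 𝓢'(TF.Rd d, ℂ)) (φ₁ φ₂ : 𝓢(TF.Rd d, ℂ)) (C : ℝ),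
      (∀ x ξ η y : TF.Rd d,
        ω₀ (TF.pt x ξ, TF.pt η y) ≤ C * ω₁ (-x - y, η) * ω₂ (-y, ξ + η)) →
      TF.mixedNorm₁ p q ω₀ (TF.stft (TF.schwartzSTFT φ₁ φ₂) (TF.distSTFT f₁ f₂)) ≤
        ENNReal.ofReal C *
          (TF.mixedNorm₁ p q ω₁ (TF.stft φ₁ f₁) * TF.mixedNorm₂ q p ω₂ (TF.stft φ₂ f₂))) ∧
    -- (2)
    (∀ (f₁ f₂ : 𝓢'(TF.Rd d, ℂ)) (φ₁ φ₂ : 𝓢(TF.Rd d, ℂ)) (C : ℝ),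
      (∀ x ξ η y : TF.Rd d,
        ω₁ (-x - y, η) * ω₂ (-y, ξ + η) ≤ C * ω₀ (TF.pt x ξ, TF.pt η y)) →
      TF.mixedNorm₁ p q ω₁ (TF.stft φ₁ f₁) * TF.mixedNorm₂ q p ω₂ (TF.stft φ₂ f₂) ≤
        ENNReal.ofReal C *
          TF.mixedNorm₁ p q ω₀ (TF.stft (TF.schwartzSTFT φ₁ φ₂) (TF.distSTFT f₁ f₂))) ∧
    -- (3), for arbitrary nonzero windows in the definitions of the three spaces
    ((∃ C : ℝ, ∀ x ξ η y : TF.Rd d,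
        ω₀ (TF.pt x ξ, TF.pt η y) ≤ C * ω₁ (-x - y, η) * ω₂ (-y, ξ + η)) →
      (∃ C : ℝ, ∀ x ξ η y : TF.Rd d,
        ω₁ (-x - y, η) * ω₂ (-y, ξ + η) ≤ C * ω₀ (TF.pt x ξ, TF.pt η y)) →
      ∀ (χ₁ χ₂ : 𝓢(TF.Rd d, ℂ)) (Φ : 𝓢(TF.R2d d, ℂ)), χ₁ ≠ 0 → χ₂ ≠ 0 → Φ ≠ 0 →
        (∀ f₁ f₂ : 𝓢'(TF.Rd d, ℂ), f₁ ≠ 0 → f₂ ≠ 0 →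
          ((f₁ ∈ TF.modSpace p q ω₁ χ₁ ∧ f₂ ∈ TF.wienerSpace q p ω₂ χ₂) ↔
            TF.distSTFT f₁ f₂ ∈ TF.modSpace p q ω₀ Φ)) ∧
        ∃ C : ℝ, 0 < C ∧ ∀ f₁ f₂ : 𝓢'(TF.Rd d, ℂ),
          ENNReal.ofReal C⁻¹ * TF.modNorm p q ω₀ Φ (TF.distSTFT f₁ f₂) ≤
              TF.modNorm p q ω₁ χ₁ f₁ * TF.wienerNorm q p ω₂ χ₂ f₂ ∧
            TF.modNorm p q ω₁ χ₁ f₁ * TF.wienerNorm q p ω₂ χ₂ f₂ ≤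
              ENNReal.ofReal C * TF.modNorm p q ω₀ Φ (TF.distSTFT f₁ f₂)) := by
  refine ⟨fun f₁ f₂ φ₁ φ₂ C h => TF.mixedNorm_stft_distSTFT_le hω₀ hω₁ hω₂ p q f₁ f₂ φ₁ φ₂ C h,
    fun f₁ f₂ φ₁ φ₂ C h => TF.mixedNorm_mul_le hω₀ hω₁ hω₂ p q f₁ f₂ φ₁ φ₂ C h, ?_⟩
  rintro ⟨C₁, h₁⟩ ⟨C₂, h₂⟩ χ₁ χ₂ Φ hχ₁ hχ₂ hΦ
  obtain ⟨C, hC, h⟩ := TF.modNorm_distSTFT_equiv hp hq hω₀ hω₁ hω₂ h₁ h₂ hχ₁ hχ₂ hΦ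
  refine ⟨fun f₁ f₂ hf₁ hf₂ => ?_, C, hC, fun f₁ f₂ => ⟨?_, (h f₁ f₂).2⟩⟩
  · have hn₁ := TF.modNorm_ne_zero hp hq hω₁ hχ₁ hf₁
    have hn₂ := TF.wienerNorm_ne_zero hq hp hω₂ hχ₂ hf₂
    have hiff : TF.modNorm p q ω₀ Φ (TF.distSTFT f₁ f₂) < ∞ ↔
        TF.modNorm p q ω₁ χ₁ f₁ * TF.wienerNorm q p ω₂ χ₂ f₂ < ∞ :=
      ⟨fun hlt => (h f₁ f₂).2.trans_lt (ENNReal.mul_lt_top ENNReal.ofReal_lt_top hlt),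
        fun hlt => (h f₁ f₂).1.trans_lt (ENNReal.mul_lt_top ENNReal.ofReal_lt_top hlt)⟩
    simp only [TF.modSpace, TF.wienerSpace, Set.mem_ofPred_eq]
    -- A product in [0, ∞] is also finite when one factor is 0; nonvanishing of both norms excludes
    -- this, which is where f₁ ≠ 0 and f₂ ≠ 0 enter.
    rw [hiff, ENNReal.mul_lt_top_iff]
    simp [hn₁, hn₂]
  · have hinv : ENNReal.ofReal C⁻¹ * ENNReal.ofReal C = 1 := by
      rw [← ENNReal.ofReal_mul (by positivity), inv_mul_cancel₀ hC.ne', ENNReal.ofReal_one]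
    calc _ ≤ ENNReal.ofReal C⁻¹ * (ENNReal.ofReal C *
          (TF.modNorm p q ω₁ χ₁ f₁ * TF.wienerNorm q p ω₂ χ₂ f₂)) := by
          gcongr
          exact (h f₁ f₂).1
      _ = _ := by rw [← mul_assoc, hinv, one_mul]
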